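/- **Setting.** Let $\mathfrak H$ be a real Hilbert space, $\mathfrak H_{\mathbb C}=\mathfrak H+i\mathfrak H$ its complexification with inner product $\langle x+iy,u+iv\rangle_{\mathbb C}=\langle x,u\rangle+\langle y,v\rangle+i\langle y,u\rangle-i\langle x,v\rangle$ and conjugation $C(x+iy)=x-iy$. For a bounded complex-linear operator $S$ on $\mathfrak H_{\mathbb C}$ put $S^\flat=CSC$; for $T\in\mathcal B(\mathfrak H)$ put $T_{\mathbb C}(x+iy)=Tx+iTy$. For a bounded operator $R$ on a real Hilbert space let $\sigma_{\mathbb C}(R)=\{u+iv:\ u,v\in\mathbb R,\ (u-R)^2+v^2\text{ is not invertible}\}$. For $A\subset\mathbb C$ let $A^c=\{\bar z: z\in A\}$, and let $[A]$ be the closure of $A$. A *spectral measure* on a $\sigma$-algebra $\Sigma$ of subsets of a set $X$, in a real or complex Hilbert space $K$, is a map $F$ from $\Sigma$ to the self-adjoint projections of $K$ with $F(\emptyset)=0$, $F(X)=1$, $F(A\cap B)=F(A)F(B)$, such that $A\mapsto\langle F(A)x,y\rangle$ is countably additive for all $x,y\in K$. **Theorem.** Let $T\in\mathcal B(\mathfrak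 H)$ be normal and $\mathfrak S=\sigma(T_{\mathbb C})$, a conjugate symmetric set. There is a unique spectral measure $E_{\mathbb C}$ on the Borel subsets of $\mathfrak S$, in $\mathfrak H_{\mathbb C}$, with $T_{\mathbb C}=\int_{\mathfrak S}z\,dE_{\mathbb C}(z)$, i.e. $\langle T_{\mathbb C}\xi,\eta\rangle_{\mathbb C}=\int_{\mathfrak S} z\,d\langle E_{\mathbb C}(\cdot)\xi,\eta\rangle_{\mathbb C}$ for all $\xi,\eta\in\mathfrak H_{\mathbb C}$ (the spectral measure of $T_{\mathbb C}$). Put $$\mathrm{Bor}_{E_{\mathbb C}}(\mathfrak S)=\{A\subset\mathfrak S\text{ Borel}:\ E_{\mathbb C}(A)^\flat=E_{\mathbb C}(A)\}.$$ Then $\mathrm{Bor}_{E_{\mathbb C}}(\mathfrak S)$ is a $\sigma$-algebra, it equals $\{A\subset\mathfrak S\text{ Borel}:\ E_{\mathbb C}(A)=E_{\mathbb C}(A^c)\}$, and $E_{\mathbb R}(A)=E_{\mathbb C}(A)|_{\mathfrak H}$, $A\in\mathrm{Bor}_{E_{\mathbb C}}(\mathfrak S)$, defines a spectral measure in $\mathfrak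 H$. For $x,y\in\mathfrak H$ let $\mu_{x,y}(A)=\langle E_{\mathbb C}(A)x,y\rangle_{\mathbb C}$ for Borel $A\subset\mathfrak S$; this complex measure satisfies $\mu_{x,y}(A)=\langle E_{\mathbb R}(A)x,y\rangle$ for $A\in\mathrm{Bor}_{E_{\mathbb C}}(\mathfrak S)$. Let $L^\infty_s(\mathfrak S,E_{\mathbb C})$ be the real algebra of Borel functions $f:\mathfrak S\to\mathbb C$ with $\|f\|_\infty:=\inf\{r>0: E_{\mathbb C}(\{|f|\ge r\})=0\}<\infty$ and $f(\bar z)=\overline{f(z)}$ outside a set $N$ with $E_{\mathbb C}(N)=0$ (stem functions), modulo functions vanishing outside such a null set. Every $f$ in it is $\mu_{x,y}$-integrable, and the formula $$\langle\Phi(f)x,y\rangle=\int_{\mathfrak S}f\,d\mu_{x,y},\qquad x,y\in\mathfrak H,$$ defines a unital morphism of real algebras $\Phi:L^\infty_s(\mathfrak S,E_{\mathbb C})\to\mathcal B(\mathfrak H)$ with $\|\Phi(f)\|=\|f\|_\infty$ for all $f$. If $f$ is $\mathrm{Bor}_{E_{\mathbb C}}(\mathfrak S)$-measurable, then also $\langle\Phi(f)x,y\rangle=\int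 f\,d\langle E_{\mathbb R}(\cdot)x,y\rangle$. Moreover: (i) every polynomial $p(z)=\sum_{j=0}^na_jz^j$ with real coefficients belongs to $L^\infty_s(\mathfrak S,E_{\mathbb C})$, and $\Phi(p)=\sum_{j=0}^na_jT^j$; (ii) for every $f\in L^\infty_s(\mathfrak S,E_{\mathbb C})$ the operator $\Phi(f)$ is normal, $\bar f\in L^\infty_s(\mathfrak S,E_{\mathbb C})$, and $\Phi(\bar f)=\Phi(f)^*$; (iii) for every $f\in L^\infty_s(\mathfrak S,E_{\mathbb C})$ the function $|f|^2$ is $\mathrm{Bor}_{E_{\mathbb C}}(\mathfrak S)$-measurable and $\|\Phi(f)x\|^2=\int_{\mathfrak S}|f|^2\,d\langle E_{\mathbb R}(\cdot)x,x\rangle$ for all $x\in\mathfrak H$; (iv) for every $A\in\mathrm{Bor}_{E_{\mathbb C}}(\mathfrak S)$ the subspace $E_{\mathbb R}(A)\mathfrak H$ is invariant under $T$ and $\sigma_{\mathbb C}(T|_{E_{\mathbb R}(A)\mathfrak H})\subset[A]$; (v) if $S\in\mathcal B(\mathfrak H)$ and $ST=TS$, then $SE_{\mathbb R}(A)=E_{\mathbb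 R}(A)S$ for all $A\in\mathrm{Bor}_{E_{\mathbb C}}(\mathfrak S)$. -/

import Mathlib

open MeasureTheory Set Function
open scoped ComplexConjugate Polynomial

noncomputable section

set_option linter.unusedSectionVars false
set_option linter.unnecessarySeqFocus false

/-! ### Complexification of a real Hilbert space -/

/-- The complexification `H + iH` of a real vector space `H`: the pair `(re, im)` stands for
`re + i im`. -/
@[ext]
structure Complexification (H : Type*) where
  re : H
  im : H

namespace Complexification

section Algebra

variable {H : Type*} [NormedAddCommGroup H] [InnerProductSpace ℝ H]

instance : Zero (Complexification H) := ⟨⟨0, 0⟩⟩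
instance : Add (Complexification H) := ⟨fun a b => ⟨a.re + b.re, a.im + b.im⟩⟩
instance : Neg (Complexification H) := ⟨fun a => ⟨-a.re, -a.im⟩⟩
instance : Sub (Complexification H) := ⟨fun a b => ⟨a.re - b.re, a.im - b.im⟩⟩
instance : SMul ℕ (Complexification H) := ⟨fun n a => ⟨n • a.re, n • a.im⟩⟩
instance : SMul ℤ (Complexification H) := ⟨fun n a => ⟨n • a.re, n • a.im⟩⟩
instance : SMul ℂ (Complexification H) :=
  ⟨fun z a => ⟨z.re • a.re - z.im • a.im, z.re • a.im + z.im • a.re⟩⟩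

@[simp] theorem zero_re : (0 : Complexification H).re = 0 := rfl
@[simp] theorem zero_im : (0 : Complexification H).im = 0 := rfl
@[simp] theorem add_re (a b : Complexification H) : (a + b).re = a.re + b.re := rfl
@[simp] theorem add_im (a b : Complexification H) : (a + b).im = a.im + b.im := rfl
@[simp] theorem neg_re (a : Complexification H) : (-a).re = -a.re := rfl
@[simp] theorem neg_im (a : Complexification H) : (-a).im = -a.im := rfl
@[simp] theorem sub_re (a b : Complexification H) : (a - b).re = a.re - b.re := rfl
@[simp] theorem sub_im (a b : Complexification H) : (a - b).im = a.im - b.im := rfl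
@[simp] theorem smul_re (z : ℂ) (a : Complexification H) :
    (z • a).re = z.re • a.re - z.im • a.im := rfl
@[simp] theorem smul_im (z : ℂ) (a : Complexification H) :
    (z • a).im = z.re • a.im + z.im • a.re := rfl

theorem toProd_injective :
    Injective (fun a : Complexification H => ((a.re, a.im) : H × H)) := by
  intro a b h
  simp only [Prod.mk.injEq] at h
  exact Complexification.ext h.1 h.2

instance : AddCommGroup (Complexification H) :=
  toProd_injective.addCommGroup (fun a : Complexification H => ((a.re, a.im) : H × H))
    rfl (fun _ _ => rfl) (fun _ => rfl) (fun _ _ => rfl) (fun _ _ => rfl) (fun _ _ => rfl)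

instance : Module ℂ (Complexification H) where
  one_smul a := by ext <;> simp
  mul_smul z w a := by
    ext <;> simp only [smul_re, smul_im, Complex.mul_re, Complex.mul_im] <;> module
  smul_zero z := by ext <;> simp
  smul_add z a b := by ext <;> simp <;> module
  add_smul z w a := by ext <;> simp <;> module
  zero_smul a := by ext <;> simp

/-- The inner product of `H + iH`, conjugate-linear in the first variable as everywhere in
Mathlib: `inner ℂ b a` is
`⟪a.re, b.re⟫ + ⟪a.im, b.im⟫ + i ⟪a.im, b.re⟫ - i ⟪a.re, b.im⟫`. -/
@[reducible] def core : InnerProductSpace.Core ℂ (Complexification H) where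
  inner b a := ⟨inner ℝ a.re b.re + inner ℝ a.im b.im, inner ℝ a.im b.re - inner ℝ a.re b.im⟩
  conj_inner_symm a b := by
    apply Complex.ext
    · simp [real_inner_comm]
    · simp [real_inner_comm]
  re_inner_nonneg a := by
    change 0 ≤ inner ℝ a.re a.re + inner ℝ a.im a.im
    exact add_nonneg real_inner_self_nonneg real_inner_self_nonneg
  add_left a b c := by
    apply Complex.ext
    · simp [inner_add_right]; ring
    · simp [inner_add_right]; ring
  smul_left a b z := by
    apply Complex.ext
    · simp [inner_add_right, inner_sub_right, inner_smul_right]; ring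
    · simp [inner_add_right, inner_sub_right, inner_smul_right]; ring
  definite a h := by
    have h' : inner ℝ a.re a.re + inner ℝ a.im a.im = 0 := congrArg Complex.re h
    have h1 : (0 : ℝ) ≤ inner ℝ a.re a.re := real_inner_self_nonneg
    have h2 : (0 : ℝ) ≤ inner ℝ a.im a.im := real_inner_self_nonneg
    have h3 : (inner ℝ a.re a.re : ℝ) = 0 := by linarith
    have h4 : (inner ℝ a.im a.im : ℝ) = 0 := by linarith
    exact Complexification.ext (inner_self_eq_zero.1 h3) (inner_self_eq_zero.1 h4)

instance : NormedAddCommGroup (Complexification H) :=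
  (core (H := H)).toNormedAddCommGroup

instance : InnerProductSpace ℂ (Complexification H) :=
  InnerProductSpace.ofCore (core (H := H)).toCore

theorem inner_def (b a : Complexification H) :
    inner ℂ b a = (⟨inner ℝ a.re b.re + inner ℝ a.im b.im,
      inner ℝ a.im b.re - inner ℝ a.re b.im⟩ : ℂ) := rfl

theorem norm_sq (a : Complexification H) : ‖a‖ ^ 2 = ‖a.re‖ ^ 2 + ‖a.im‖ ^ 2 := by
  rw [← inner_self_eq_norm_sq (𝕜 := ℂ) a, inner_def]
  simp

theorem norm_re_le (a : Complexification H) : ‖a.re‖ ≤ ‖a‖ := by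
  have := norm_sq a
  exact abs_le_of_sq_le_sq' (by nlinarith [sq_nonneg ‖a.im‖]) (norm_nonneg a) |>.2

theorem norm_im_le (a : Complexification H) : ‖a.im‖ ≤ ‖a‖ := by
  have := norm_sq a
  exact abs_le_of_sq_le_sq' (by nlinarith [sq_nonneg ‖a.re‖]) (norm_nonneg a) |>.2

theorem norm_le_add (a : Complexification H) : ‖a‖ ≤ ‖a.re‖ + ‖a.im‖ := by
  have := norm_sq a
  have h1 := norm_nonneg a.re
  have h2 := norm_nonneg a.im
  exact abs_le_of_sq_le_sq' (by nlinarith) (by positivity) |>.2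

instance [CompleteSpace H] : CompleteSpace (Complexification H) := by
  refine Metric.complete_of_cauchySeq_tendsto fun u hu => ?_
  have hre : CauchySeq fun n => (u n).re := by
    refine Metric.cauchySeq_iff.2 fun ε hε => ?_
    obtain ⟨N, hN⟩ := Metric.cauchySeq_iff.1 hu ε hε
    refine ⟨N, fun m hm n hn => lt_of_le_of_lt ?_ (hN m hm n hn)⟩
    rw [dist_eq_norm, dist_eq_norm, ← sub_re]
    exact norm_re_le _
  have him : CauchySeq fun n => (u n).im := by
    refine Metric.cauchySeq_iff.2 fun ε hε => ?_
    obtain ⟨N, hN⟩ := Metric.cauchySeq_iff.1 hu ε hε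
    refine ⟨N, fun m hm n hn => lt_of_le_of_lt ?_ (hN m hm n hn)⟩
    rw [dist_eq_norm, dist_eq_norm, ← sub_im]
    exact norm_im_le _
  obtain ⟨x, hx⟩ := cauchySeq_tendsto_of_complete hre
  obtain ⟨y, hy⟩ := cauchySeq_tendsto_of_complete him
  refine ⟨⟨x, y⟩, ?_⟩
  rw [tendsto_iff_norm_sub_tendsto_zero] at hx hy ⊢
  refine squeeze_zero (fun n => norm_nonneg _) (fun n => norm_le_add _) ?_
  simpa using hx.add hy

/-- The embedding `x ↦ x + i0` of `H` into its complexification. -/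
def ofReal (x : H) : Complexification H := ⟨x, 0⟩

/-- The conjugation `C : x + iy ↦ x - iy`. -/
def conjC : Complexification H →L⋆[ℂ] Complexification H :=
  LinearMap.mkContinuous
    { toFun := fun a => ⟨a.re, -a.im⟩
      map_add' := fun a b => by ext <;> simp <;> abel
      map_smul' := fun z a => by ext <;> simp <;> abel } 1 (fun a => by
        rw [one_mul]
        refine abs_le_of_sq_le_sq' (le_of_eq ?_) (norm_nonneg a) |>.2
        rw [norm_sq, norm_sq]
        simp)

@[simp] theorem conjC_re (a : Complexification H) : (conjC a).re = a.re := rfl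
@[simp] theorem conjC_im (a : Complexification H) : (conjC a).im = -a.im := rfl

@[simp] theorem conjC_conjC (a : Complexification H) : conjC (conjC a) = a := by
  ext <;> simp

/-- `S♭ = C S C`. -/
def flat (S : Complexification H →L[ℂ] Complexification H) :
    Complexification H →L[ℂ] Complexification H :=
  conjC.comp (S.comp conjC)

@[simp] theorem flat_apply (S : Complexification H →L[ℂ] Complexification H)
    (a : Complexification H) : flat S a = conjC (S (conjC a)) := rfl

/-- The complex extension `T_ℂ (x + iy) = T x + i T y` of a bounded real operator. -/
def complexExt (T : H →L[ℝ] H) : Complexification H →L[ℂ] Complexification H :=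
  LinearMap.mkContinuous
    { toFun := fun a => ⟨T a.re, T a.im⟩
      map_add' := fun a b => by ext <;> simp
      map_smul' := fun z a => by ext <;> simp } (‖T‖ + ‖T‖) (fun a => by
        refine (norm_le_add _).trans ?_
        rw [add_mul]
        exact add_le_add ((T.le_opNorm _).trans (by gcongr; exact norm_re_le a))
          ((T.le_opNorm _).trans (by gcongr; exact norm_im_le a)))

@[simp] theorem complexExt_re (T : H →L[ℝ] H) (a : Complexification H) :
    (complexExt T a).re = T a.re := rfl
@[simp] theorem complexExt_im (T : H →L[ℝ] H) (a : Complexification H) :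
    (complexExt T a).im = T a.im := rfl

theorem flat_mul (S R : Complexification H →L[ℂ] Complexification H) :
    flat (S * R) = flat S * flat R := by
  ext a <;> simp

theorem isUnit_flat {S : Complexification H →L[ℂ] Complexification H} (h : IsUnit S) :
    IsUnit (flat S) := by
  obtain ⟨u, rfl⟩ := h
  have h1 : flat (1 : Complexification H →L[ℂ] Complexification H) = 1 := by
    ext a <;> simp
  exact ⟨⟨flat u, flat (u⁻¹ : (Complexification H →L[ℂ] Complexification H)ˣ),
    by rw [← flat_mul, Units.mul_inv, h1], by rw [← flat_mul, Units.inv_mul, h1]⟩, rfl⟩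

/-- The spectrum of `T_ℂ` is conjugate symmetric. -/
theorem conj_mem_spectrum_complexExt (T : H →L[ℝ] H) {z : ℂ} (hz : z ∈ spectrum ℂ (complexExt T)) :
    conj z ∈ spectrum ℂ (complexExt T) := by
  rw [spectrum.mem_iff] at hz ⊢
  intro h
  apply hz
  have h2 := isUnit_flat h
  convert h2 using 1
  ext a
  · simp [Algebra.algebraMap_eq_smul_one]
  · simp [Algebra.algebraMap_eq_smul_one]

end Algebra

end Complexification

open Complexification

/-- The complex spectrum of a bounded operator on a real normed space: the set of `u + iv` for
which `(u - T)² + v²` is not invertible. -/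
def complexSpectrum {V : Type*} [NormedAddCommGroup V] [NormedSpace ℝ V] (T : V →L[ℝ] V) :
    Set ℂ :=
  {z | ¬ IsUnit ((z.re • (1 : V →L[ℝ] V) - T) ^ 2 + (z.im ^ 2) • (1 : V →L[ℝ] V))}

/-! ### Spectral measures -/

/-- A spectral measure on the σ-algebra `m` with values in the self-adjoint projections of a real
or complex Hilbert space. As for `VectorMeasure`, the value on a set outside the σ-algebra is `0`
by convention. -/
@[ext]
structure SpectralMeasure {X : Type*} (m : MeasurableSpace X) (𝕜 K : Type*) [RCLike 𝕜]
    [NormedAddCommGroup K] [InnerProductSpace 𝕜 K] [CompleteSpace K] where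
  toFun : Set X → K →L[𝕜] K
  not_measurable' : ∀ A, ¬ MeasurableSet[m] A → toFun A = 0
  isStarProjection' : ∀ A, MeasurableSet[m] A → IsStarProjection (toFun A)
  empty' : toFun ∅ = 0
  univ' : toFun univ = 1
  inter' : ∀ A B, MeasurableSet[m] A → MeasurableSet[m] B → toFun (A ∩ B) = toFun A * toFun B
  iUnion' : ∀ (x y : K) (A : ℕ → Set X), (∀ n, MeasurableSet[m] (A n)) →
    Pairwise (Disjoint on A) →
    HasSum (fun n => inner 𝕜 y (toFun (A n) x)) (inner 𝕜 y (toFun (⋃ n, A n) x))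

namespace SpectralMeasure

section Basic

variable {X : Type*} {m : MeasurableSpace X} {𝕜 K : Type*} [RCLike 𝕜]
  [NormedAddCommGroup K] [InnerProductSpace 𝕜 K] [CompleteSpace K]

instance : CoeFun (SpectralMeasure m 𝕜 K) (fun _ => Set X → K →L[𝕜] K) := ⟨toFun⟩

/-- The scalar measure `A ↦ ⟨E(A)x, y⟩` (linear in `x`, conjugate-linear in `y`) associated with
a spectral measure. -/
def assoc (E : SpectralMeasure m 𝕜 K) (x y : K) : VectorMeasure X 𝕜 where
  measureOf' A := inner 𝕜 y (E A x)
  empty' := by simp [E.empty']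
  not_measurable' A hA := by simp [E.not_measurable' A hA]
  m_iUnion' A hA hd := E.iUnion' x y A hA hd

theorem assoc_apply (E : SpectralMeasure m 𝕜 K) (x y : K) (A : Set X) :
    E.assoc x y A = inner 𝕜 y (E A x) := rfl

theorem null_mono (E : SpectralMeasure m 𝕜 K) {A B : Set X} (hA : MeasurableSet[m] A)
    (hB : MeasurableSet[m] B) (h : A ⊆ B) (h0 : E B = 0) : E A = 0 := by
  have := E.inter' A B hA hB
  rwa [inter_eq_left.2 h, h0, mul_zero] at this

theorem null_union (E : SpectralMeasure m 𝕜 K) {A B : Set X} (hA : MeasurableSet[m] A)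
    (hB : MeasurableSet[m] B) (h1 : E A = 0) (h2 : E B = 0) : E (A ∪ B) = 0 := by
  have h3 : E (B \ A) = 0 := E.null_mono (hB.diff hA) hB sdiff_subset h2
  ext x
  refine ext_inner_left 𝕜 fun y => ?_
  have h4 := (E.assoc x y).of_union (A := A) (B := B \ A) disjoint_sdiff_right hA (hB.diff hA)
  rw [union_sdiff_self] at h4
  simpa [assoc_apply, h1, h3] using h4

end Basic

/-- `E` is the spectral measure of the bounded operator `S`, that is, it lives on the Borel
subsets of the spectrum of `S` and `S = ∫ z dE(z)` weakly. -/
def IsSpectralMeasureOf {K : Type*} [NormedAddCommGroup K] [InnerProductSpace ℂ K]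
    [CompleteSpace K] (S : K →L[ℂ] K)
    (E : SpectralMeasure (Subtype.instMeasurableSpace : MeasurableSpace (spectrum ℂ S)) ℂ K) : Prop :=
  ∀ ξ η : K, inner ℂ η (S ξ) = ∫ᵛ z, (z : ℂ) ∂[ContinuousLinearMap.mul ℝ ℂ; E.assoc ξ η]

end SpectralMeasure

/-! ### Essentially bounded stem functions on the spectrum of a complex extension -/

section Stem

variable {H : Type*} [NormedAddCommGroup H] [InnerProductSpace ℝ H] (T : H →L[ℝ] H)

/-- The complex conjugation on `σ(T_ℂ)`. -/
def specConj (z : spectrum ℂ (complexExt T)) : spectrum ℂ (complexExt T) :=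
  ⟨conj (z : ℂ), conj_mem_spectrum_complexExt T z.2⟩

theorem measurable_specConj : Measurable (specConj T) :=
  (Complex.continuous_conj.comp continuous_subtype_val).subtype_mk _ |>.measurable

variable {T} [CompleteSpace H]
  (E : SpectralMeasure (Subtype.instMeasurableSpace : MeasurableSpace (spectrum ℂ (complexExt T))) ℂ
    (Complexification H))

/-- The `E`-essential supremum `inf {r > 0 : E {|f| ≥ r} = 0}` of `|f|`. -/
def essNorm (f : spectrum ℂ (complexExt T) → ℂ) : ℝ :=
  sInf {r : ℝ | 0 < r ∧ E {z | r ≤ ‖f z‖} = 0}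

/-- Borel functions `f` on `σ(T_ℂ)` that are `E`-essentially bounded and satisfy
`f (conj z) = conj (f z)` outside an `E`-null set, as a real algebra of functions. -/
def stemFunctions : Subalgebra ℝ (spectrum ℂ (complexExt T) → ℂ) where
  carrier := {f | Measurable f ∧ (∃ r : ℝ, 0 < r ∧ E {z | r ≤ ‖f z‖} = 0) ∧
    E {z | f (specConj T z) ≠ conj (f z)} = 0}
  mul_mem' := by
    rintro f g ⟨hf, ⟨r, hr, hr'⟩, hf'⟩ ⟨hg, ⟨s, hs, hs'⟩, hg'⟩
    have hfc := hf.comp (measurable_specConj T)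
    have hgc := hg.comp (measurable_specConj T)
    have hfs := Complex.continuous_conj.measurable.comp hf
    have hgs := Complex.continuous_conj.measurable.comp hg
    have hfg := Complex.continuous_conj.measurable.comp (hf.mul hg)
    refine ⟨hf.mul hg, ⟨r * s, by positivity, ?_⟩, ?_⟩
    · have h1 := measurableSet_le (measurable_const (a := r)) hf.norm
      have h2 := measurableSet_le (measurable_const (a := s)) hg.norm
      refine E.null_mono (measurableSet_le measurable_const (hf.mul hg).norm) (h1.union h2) ?_
        (E.null_union h1 h2 hr' hs')
      intro z hz
      by_contra hc
      simp only [mem_union, mem_ofPred_eq, not_or, not_le] at hc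
      have : ‖(f * g) z‖ < r * s := by
        rw [Pi.mul_apply, norm_mul]
        exact mul_lt_mul'' hc.1 hc.2 (norm_nonneg _) (norm_nonneg _)
      exact absurd hz (not_le.2 this)
    · have h1 := (measurableSet_eq_fun hfc hfs).compl
      have h2 := (measurableSet_eq_fun hgc hgs).compl
      refine E.null_mono
        (measurableSet_eq_fun (hfc.mul hgc) hfg).compl (h1.union h2) ?_
        (E.null_union h1 h2 hf' hg')
      intro z hz
      by_contra hc
      simp only [mem_union, mem_compl_iff, mem_ofPred_eq, not_or, not_not, comp_apply] at hc
      exact hz (by simp [hc.1, hc.2])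
  add_mem' := by
    rintro f g ⟨hf, ⟨r, hr, hr'⟩, hf'⟩ ⟨hg, ⟨s, hs, hs'⟩, hg'⟩
    have hfc := hf.comp (measurable_specConj T)
    have hgc := hg.comp (measurable_specConj T)
    have hfs := Complex.continuous_conj.measurable.comp hf
    have hgs := Complex.continuous_conj.measurable.comp hg
    have hfg := Complex.continuous_conj.measurable.comp (hf.add hg)
    refine ⟨hf.add hg, ⟨r + s, by positivity, ?_⟩, ?_⟩
    · have h1 := measurableSet_le (measurable_const (a := r)) hf.norm
      have h2 := measurableSet_le (measurable_const (a := s)) hg.norm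
      refine E.null_mono (measurableSet_le measurable_const (hf.add hg).norm) (h1.union h2) ?_
        (E.null_union h1 h2 hr' hs')
      intro z hz
      by_contra hc
      simp only [mem_union, mem_ofPred_eq, not_or, not_le] at hc
      have : ‖(f + g) z‖ < r + s :=
        lt_of_le_of_lt (norm_add_le _ _) (add_lt_add hc.1 hc.2)
      exact absurd hz (not_le.2 this)
    · have h1 := (measurableSet_eq_fun hfc hfs).compl
      have h2 := (measurableSet_eq_fun hgc hgs).compl
      refine E.null_mono
        (measurableSet_eq_fun (hfc.add hgc) hfg).compl (h1.union h2) ?_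
        (E.null_union h1 h2 hf' hg')
      intro z hz
      by_contra hc
      simp only [mem_union, mem_compl_iff, mem_ofPred_eq, not_or, not_not, comp_apply] at hc
      exact hz (by simp [hc.1, hc.2])
  algebraMap_mem' a := by
    refine ⟨measurable_const, ⟨‖a‖ + 1, by positivity, ?_⟩, ?_⟩
    · convert E.empty'
      ext z
      simp
    · convert E.empty'
      ext z
      simp

/-- The ideal of `E`-almost everywhere vanishing functions. -/
def nullFunctions : Ideal (stemFunctions E) where
  carrier := {f | E {z | f.1 z ≠ 0} = 0}
  zero_mem' := by
    change E {z | (0 : ℂ) ≠ 0} = 0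
    convert E.empty'
    ext z
    simp
  add_mem' := by
    intro f g hf hg
    have h1 := (measurableSet_eq_fun f.2.1 (measurable_const (a := (0 : ℂ)))).compl
    have h2 := (measurableSet_eq_fun g.2.1 (measurable_const (a := (0 : ℂ)))).compl
    refine E.null_mono
      (measurableSet_eq_fun (f + g).2.1 (measurable_const (a := (0 : ℂ)))).compl
      (h1.union h2) ?_ (E.null_union h1 h2 hf hg)
    intro z hz
    by_contra hc
    simp only [mem_union, mem_compl_iff, mem_ofPred_eq, not_or, not_not] at hc
    exact hz (by change f.1 z + g.1 z = 0; simp [hc.1, hc.2])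
  smul_mem' := by
    intro c f hf
    have h1 := (measurableSet_eq_fun f.2.1 (measurable_const (a := (0 : ℂ)))).compl
    refine E.null_mono
      (measurableSet_eq_fun (c * f).2.1 (measurable_const (a := (0 : ℂ)))).compl h1 ?_ hf
    intro z hz
    by_contra hc
    simp only [mem_compl_iff, mem_ofPred_eq, not_not] at hc
    exact hz (by change c.1 z * f.1 z = 0; simp [hc])

/-- The real algebra `L^∞_s(σ(T_ℂ), E)` of classes of `E`-essentially bounded stem functions. -/
abbrev LinfStem : Type := stemFunctions E ⧸ nullFunctions E

/-- The class of an essentially bounded stem function. -/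
abbrev LinfStem.mk (f : stemFunctions E) : LinfStem E := Ideal.Quotient.mk (nullFunctions E) f

end Stem

end

open Complexification (ofReal flat complexExt)

/-! The spectral theorem is obtained from the continuous functional calculus. A star representation
`ρ` of `C(X, ℂ)` yields, by Riesz–Markov, a positive measure `μ_ξ` for each vector, with `∫ g dμ_ξ =
⟨ρ(g)ξ, ξ⟩`. Hence `‖ρ(g)ξ‖` is the `L²(μ_ξ)` norm of `g` (`enorm_rep`), and density of continuous
functions in `L²` extends `g ↦ ρ(g)ξ` to bounded Borel functions. Indicators give the projections of
`exists_spectralMeasure`. Conversely a spectral measure integrates to an isometry of the same kind,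
so it is determined by its integrals of continuous functions; these must be `cfcHom`, whence
uniqueness. Fuglede's theorem gives the commutation statement in the same way.

The real structure comes from uniqueness. The map `A ↦ E(Aᶜᵒⁿʲ)♭` is again a spectral measure of
`T_ℂ`, because `T_ℂ♭ = T_ℂ`; so `E(A)♭ = E(Aᶜᵒⁿʲ)` (`conjugate_eq`, `flat_apply_eq`). Therefore
`E(A)` is `♭`-invariant exactly when `A` equals its conjugate up to null sets, a condition visibly
stable under complements and countable unions. Likewise `∫ f dE` is `♭`-invariant for every stem
function (`flat_int`). A `♭`-invariant operator is the complexification of its restriction to the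
real space (`complexExt_reOp`), and complexification is isometric and compatible with products and
adjoints. Thus `Φ(f)` is the restriction of `∫ f dE`, and its properties are inherited from the
complex calculus.

For the spectral inclusion, `A` is replaced by its intersection with its conjugate, which carries
the same projection. There `(u - z)² + v² = (z - w)(z - w̄)` is bounded away from zero when `w = u +
iv` is off the closure of `A`, so its reciprocal integrates to an inverse on the spectral subspace.

Identities between integrals against complex measures are all proved by one principle,
`IsBddIntegral.ext`: it suffices to check multiples of indicators. -/

noncomputable section SpectralTheory

set_option linter.unusedSectionVars false

open Filter Topology
open scoped ENNReal

/-! ### Functionals on bounded measurable functions -/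

/-- Bounded measurable complex functions. -/
structure BddMeas {X : Type*} [MeasurableSpace X] (f : X → ℂ) : Prop where
  measurable : Measurable f
  exists_bound : ∃ C : ℝ, ∀ x, ‖f x‖ ≤ C

namespace BddMeas

variable {X Y : Type*} [MeasurableSpace X] [MeasurableSpace Y] {f g : X → ℂ}

theorem const (c : ℂ) : BddMeas (fun _ : X => c) := ⟨measurable_const, ‖c‖, fun _ => le_rfl⟩

theorem add (hf : BddMeas f) (hg : BddMeas g) : BddMeas (f + g) := by
  obtain ⟨C, hC⟩ := hf.2
  obtain ⟨D, hD⟩ := hg.2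
  exact ⟨hf.1.add hg.1, C + D, fun x => (norm_add_le _ _).trans (add_le_add (hC x) (hD x))⟩

theorem sub (hf : BddMeas f) (hg : BddMeas g) : BddMeas (f - g) := by
  obtain ⟨C, hC⟩ := hf.2
  obtain ⟨D, hD⟩ := hg.2
  exact ⟨hf.1.sub hg.1, C + D, fun x => (norm_sub_le _ _).trans (add_le_add (hC x) (hD x))⟩

theorem mul (hf : BddMeas f) (hg : BddMeas g) : BddMeas (f * g) := by
  obtain ⟨C, hC⟩ := hf.2
  obtain ⟨D, hD⟩ := hg.2
  refine ⟨hf.1.mul hg.1, C * D, fun x => ?_⟩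
  rw [Pi.mul_apply, norm_mul]
  exact mul_le_mul (hC x) (hD x) (norm_nonneg _) ((norm_nonneg _).trans (hC x))

theorem conj_comp (hf : BddMeas f) : BddMeas (fun x => conj (f x)) := by
  obtain ⟨C, hC⟩ := hf.2
  exact ⟨Complex.continuous_conj.measurable.comp hf.1, C, fun x => by simpa using hC x⟩

theorem comp {φ : Y → X} (hf : BddMeas f) (hφ : Measurable φ) : BddMeas (f ∘ φ) := by
  obtain ⟨C, hC⟩ := hf.2
  exact ⟨hf.1.comp hφ, C, fun x => hC _⟩

theorem indicator (hf : BddMeas f) {A : Set X} (hA : MeasurableSet A) :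
    BddMeas (A.indicator f) := by
  obtain ⟨C, hC⟩ := hf.2
  exact ⟨hf.1.indicator hA, C, fun x => (norm_indicator_le_norm_self _ _).trans (hC x)⟩

theorem of_continuous {Z : Type*} [TopologicalSpace Z] [CompactSpace Z] [MeasurableSpace Z]
    [OpensMeasurableSpace Z] (g : C(Z, ℂ)) : BddMeas g :=
  ⟨g.continuous.measurable, ‖g‖, g.norm_coe_le_norm⟩

theorem integrable (hf : BddMeas f) (μ : Measure X) [IsFiniteMeasure μ] : Integrable f μ := by
  obtain ⟨C, hC⟩ := hf.2
  exact Integrable.of_bound hf.1.aestronglyMeasurable C (Eventually.of_forall hC)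

end BddMeas

/-- Additive functionals on bounded measurable functions which are continuous with respect to
bounded pointwise convergence of sequences. -/
structure IsBddIntegral {X : Type*} [MeasurableSpace X] (L : (X → ℂ) → ℂ) : Prop where
  map_add : ∀ f g, BddMeas f → BddMeas g → L (f + g) = L f + L g
  tendsto : ∀ (F : ℕ → X → ℂ) (f : X → ℂ) (C : ℝ), (∀ n, Measurable (F n)) → Measurable f →
    (∀ n x, ‖F n x‖ ≤ C) → (∀ x, Tendsto (fun n => F n x) atTop (𝓝 (f x))) →
    Tendsto (fun n => L (F n)) atTop (𝓝 (L f))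

namespace IsBddIntegral

variable {X Y : Type*} {_ : MeasurableSpace X} {_ : MeasurableSpace Y} {L M : (X → ℂ) → ℂ}

/-- Two such functionals agree as soon as they agree on multiples of indicators. -/
theorem ext (hL : IsBddIntegral L) (hM : IsBddIntegral M)
    (h : ∀ (A : Set X) (c : ℂ), MeasurableSet A →
      L (A.indicator fun _ => c) = M (A.indicator fun _ => c))
    {f : X → ℂ} (hf : BddMeas f) : L f = M f := by
  have hs : ∀ s : SimpleFunc X ℂ, L s = M s := by
    intro s
    induction s using SimpleFunc.induction with
    | @const c A hA =>
      classical
      rw [SimpleFunc.coe_piecewise, SimpleFunc.coe_const, SimpleFunc.coe_const,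
        Function.const_zero, piecewise_eq_indicator]
      exact h _ c hA
    | @add s t _ hs ht =>
      have hb : ∀ s : SimpleFunc X ℂ, BddMeas s := fun s => ⟨s.measurable, s.exists_forall_norm_le⟩
      rw [SimpleFunc.coe_add, hL.map_add _ _ (hb s) (hb t), hM.map_add _ _ (hb s) (hb t), hs, ht]
  obtain ⟨C, hC⟩ := hf.2
  have hsm := hf.1.stronglyMeasurable
  -- Truncation needs a nonnegative bound, and `C` may be negative when the space is empty.
  have hC' : ∀ x, ‖f x‖ ≤ max C 0 := fun x => (hC x).trans (le_max_left _ _)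
  have h1 : ∀ n x, ‖hsm.approxBounded (max C 0) n x‖ ≤ max C 0 := fun n x =>
    hsm.norm_approxBounded_le (le_max_right _ _) n x
  have h2 : ∀ x, Tendsto (fun n => hsm.approxBounded (max C 0) n x) atTop (𝓝 (f x)) := fun x =>
    hsm.tendsto_approxBounded_of_norm_le (hC' x)
  have h3 := hL.tendsto _ f _ (fun n => (hsm.approxBounded (max C 0) n).measurable) hf.1 h1 h2
  have h4 := hM.tendsto _ f _ (fun n => (hsm.approxBounded (max C 0) n).measurable) hf.1 h1 h2
  simp only [hs] at h3
  exact tendsto_nhds_unique h3 h4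

theorem add (hL : IsBddIntegral L) (hM : IsBddIntegral M) : IsBddIntegral (fun f => L f + M f) where
  map_add f g hf hg := by rw [hL.map_add f g hf hg, hM.map_add f g hf hg]; ring
  tendsto F f C hF hf hC h := (hL.tendsto F f C hF hf hC h).add (hM.tendsto F f C hF hf hC h)

theorem const_mul (hL : IsBddIntegral L) (c : ℂ) : IsBddIntegral (fun f => c * L f) where
  map_add f g hf hg := by rw [hL.map_add f g hf hg]; ring
  tendsto F f C hF hf hC h := (hL.tendsto F f C hF hf hC h).const_mul c

theorem conj_comp (hL : IsBddIntegral L) : IsBddIntegral (fun f => conj (L fun x => conj (f x))) where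
  map_add f g hf hg := by
    rw [← _root_.map_add, ← hL.map_add _ _ hf.conj_comp hg.conj_comp]
    congr 2
    ext x
    simp
  tendsto F f C hF hf hC h :=
    (Complex.continuous_conj.tendsto _).comp (hL.tendsto _ _ C
      (fun n => Complex.continuous_conj.measurable.comp (hF n))
      (Complex.continuous_conj.measurable.comp hf) (fun n x => by simpa using hC n x)
      (fun x => (Complex.continuous_conj.tendsto _).comp (h x)))

theorem comp {φ : X → Y} (hL : IsBddIntegral L) (hφ : Measurable φ) :
    IsBddIntegral (fun f : Y → ℂ => L (f ∘ φ)) where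
  map_add _ _ hf hg := hL.map_add _ _ (hf.comp hφ) (hg.comp hφ)
  tendsto _ _ C hF hf hC h :=
    hL.tendsto _ _ C (fun n => (hF n).comp hφ) (hf.comp hφ) (fun n _ => hC n _) (fun _ => h _)

theorem mul_left (hL : IsBddIntegral L) {g : X → ℂ} (hg : BddMeas g) :
    IsBddIntegral (fun f => L (f * g)) where
  map_add f f' hf hf' := by rw [add_mul, hL.map_add _ _ (hf.mul hg) (hf'.mul hg)]
  tendsto F f C hF hf hC h := by
    obtain ⟨D, hD⟩ := hg.2
    refine hL.tendsto _ _ (C * D) (fun n => (hF n).mul hg.1) (hf.mul hg.1) (fun n x => ?_)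
      (fun x => (h x).mul_const _)
    rw [Pi.mul_apply, norm_mul]
    exact mul_le_mul (hC n x) (hD x) (norm_nonneg _) ((norm_nonneg _).trans (hC n x))

end IsBddIntegral

/-- Dominated convergence with a constant majorant, which is integrable because the variation is
finite. -/
theorem isBddIntegral_vectorMeasure {X F : Type*} {_ : MeasurableSpace X} [NormedAddCommGroup F]
    [NormedSpace ℝ F] (μ : VectorMeasure X F) [IsFiniteMeasure μ.variation]
    (B : ℂ →L[ℝ] F →L[ℝ] ℂ) : IsBddIntegral (fun f => ∫ᵛ x, f x ∂[B; μ]) where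
  map_add _ _ hf hg := VectorMeasure.integral_add (hf.integrable _) (hg.integrable _)
  tendsto _ _ C hF _ hC h := VectorMeasure.tendsto_integral_filter_of_norm_le_const
    (Eventually.of_forall fun n => (hF n).aestronglyMeasurable)
    ⟨C, Eventually.of_forall fun n => Eventually.of_forall (hC n)⟩ (Eventually.of_forall h)

theorem isBddIntegral_measure {X : Type*} [MeasurableSpace X] (μ : Measure X) [IsFiniteMeasure μ] :
    IsBddIntegral (fun f => ∫ x, f x ∂μ) where
  map_add _ _ hf hg := integral_add (hf.integrable _) (hg.integrable _)
  tendsto _ _ C hF _ hC h := tendsto_integral_of_dominated_convergence (fun _ => C)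
    (fun n => (hF n).aestronglyMeasurable) (integrable_const _)
    (fun n => Eventually.of_forall (hC n)) (Eventually.of_forall h)

/-! ### Spectral measures -/

theorem integral_indicator_const_vectorMeasure {X F : Type*} {_ : MeasurableSpace X}
    [NormedAddCommGroup F] [NormedSpace ℝ F] (μ : VectorMeasure X F) [IsFiniteMeasure μ.variation]
    (B : ℂ →L[ℝ] F →L[ℝ] ℂ) {A : Set X} (hA : MeasurableSet A) (c : ℂ) :
    ∫ᵛ x, A.indicator (fun _ => c) x ∂[B; μ] = B c (μ A) :=
  VectorMeasure.integral_indicator_const c hA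

namespace SpectralMeasure

section Basic

variable {X : Type*} {m : MeasurableSpace X} {𝕜 K : Type*} [RCLike 𝕜]
  [NormedAddCommGroup K] [InnerProductSpace 𝕜 K] [CompleteSpace K] (E : SpectralMeasure m 𝕜 K)

theorem adjoint_apply {A : Set X} (hA : MeasurableSet[m] A) (x y : K) :
    inner 𝕜 y (E A x) = inner 𝕜 (E A y) x := by
  rw [← ContinuousLinearMap.adjoint_inner_left]
  congr 2
  exact (E.isStarProjection' A hA).isSelfAdjoint

theorem apply_apply {A B : Set X} (hA : MeasurableSet[m] A) (hB : MeasurableSet[m] B) (x : K) :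
    E A (E B x) = E (A ∩ B) x := by
  rw [E.inter' A B hA hB]; rfl

theorem apply_self {A : Set X} (hA : MeasurableSet[m] A) (x : K) : E A (E A x) = E A x := by
  rw [E.apply_apply hA hA, inter_self]

theorem inner_apply {A : Set X} (hA : MeasurableSet[m] A) (x y : K) :
    inner 𝕜 y (E A x) = inner 𝕜 (E A y) (E A x) := by
  rw [← E.adjoint_apply hA, E.apply_self hA]

theorem inner_apply_self {A : Set X} (hA : MeasurableSet[m] A) (x : K) :
    inner 𝕜 x (E A x) = ((‖E A x‖ ^ 2 : ℝ) : 𝕜) := by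
  rw [E.inner_apply hA, inner_self_eq_norm_sq_to_K]
  simp

/-- The positive measure `A ↦ ‖E(A)x‖² = ⟨E(A)x, x⟩`. -/
def diag (x : K) : Measure X :=
  Measure.ofMeasurable (fun A _ => ENNReal.ofReal (‖E A x‖ ^ 2)) (by simp [E.empty']) (by
    intro A hA hd
    have h := E.iUnion' x x A hA hd
    rw [E.inner_apply_self (MeasurableSet.iUnion hA)] at h
    simp only [E.inner_apply_self (hA _)] at h
    have h' : HasSum (fun n => ‖E (A n) x‖ ^ 2) (‖E (⋃ n, A n) x‖ ^ 2) := by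
      exact_mod_cast h
    rw [← h'.tsum_eq, ENNReal.ofReal_tsum_of_nonneg (fun _ => by positivity) h'.summable])

theorem diag_apply {A : Set X} (hA : MeasurableSet[m] A) (x : K) :
    E.diag x A = ENNReal.ofReal (‖E A x‖ ^ 2) :=
  Measure.ofMeasurable_apply _ hA

theorem diag_univ (x : K) : E.diag x univ = ENNReal.ofReal (‖x‖ ^ 2) := by
  rw [E.diag_apply MeasurableSet.univ, E.univ']; rfl

instance (x : K) : IsFiniteMeasure (E.diag x) := ⟨by rw [E.diag_univ]; exact ENNReal.ofReal_lt_top⟩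

theorem diag_real_univ (x : K) : (E.diag x).real univ = ‖x‖ ^ 2 := by
  rw [Measure.real, E.diag_univ, ENNReal.toReal_ofReal (by positivity)]

theorem diag_real {A : Set X} (hA : MeasurableSet[m] A) (x : K) :
    (E.diag x).real A = ‖E A x‖ ^ 2 := by
  rw [Measure.real, E.diag_apply hA, ENNReal.toReal_ofReal (by positivity)]

theorem diag_eq_zero {A : Set X} (hA : MeasurableSet[m] A) {x : K} :
    E.diag x A = 0 ↔ E A x = 0 := by
  rw [E.diag_apply hA, ENNReal.ofReal_eq_zero]
  constructor
  · intro h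
    have : ‖E A x‖ ^ 2 = 0 := le_antisymm h (by positivity)
    simpa using this
  · intro h
    simp [h]

theorem eq_zero_iff {A : Set X} (hA : MeasurableSet[m] A) : E A = 0 ↔ ∀ x, E.diag x A = 0 := by
  simp only [E.diag_eq_zero hA]
  exact ⟨fun h x => by simp [h], fun h => by ext x; simp [h]⟩

theorem apply_union {A B : Set X} (hA : MeasurableSet[m] A) (hB : MeasurableSet[m] B)
    (h : Disjoint A B) : E (A ∪ B) = E A + E B := by
  ext x
  refine ext_inner_left 𝕜 fun y => ?_
  have h4 := (E.assoc x y).of_union h hA hB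
  rw [assoc_apply, assoc_apply, assoc_apply, ← inner_add_right] at h4
  exact h4

theorem apply_compl {A : Set X} (hA : MeasurableSet[m] A) : E Aᶜ = 1 - E A := by
  rw [← E.univ', ← union_compl_self A, E.apply_union hA hA.compl disjoint_compl_right]
  abel

/-- If the projections agree, then `E(A \ B) = E(A)E(A \ B) = E(B)E(A \ B) = E(∅) = 0`. This trades
equality of operators for almost everywhere equality, which behaves well under set operations. -/
theorem eq_iff {A B : Set X} (hA : MeasurableSet[m] A) (hB : MeasurableSet[m] B) :
    E A = E B ↔ ∀ x, A =ᵐ[E.diag x] B := by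
  simp only [ae_eq_set]
  rw [forall_and, ← E.eq_zero_iff (hA.diff hB), ← E.eq_zero_iff (hB.diff hA)]
  have h1 : E A = E (A ∩ B) + E (A \ B) := by
    rw [← E.apply_union (hA.inter hB) (hA.diff hB) disjoint_inf_sdiff, inter_union_sdiff]
  have h2 : E B = E (A ∩ B) + E (B \ A) := by
    rw [inter_comm, ← E.apply_union (hB.inter hA) (hB.diff hA) disjoint_inf_sdiff,
      inter_union_sdiff]
  constructor
  · intro h
    constructor
    · have := E.inter' A (A \ B) hA (hA.diff hB)
      rw [inter_eq_right.2 sdiff_subset, h, ← E.inter' B (A \ B) hB (hA.diff hB),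
        inter_sdiff_self, E.empty'] at this
      exact this
    · have := E.inter' B (B \ A) hB (hB.diff hA)
      rw [inter_eq_right.2 sdiff_subset, ← h, ← E.inter' A (B \ A) hA (hB.diff hA),
        inter_sdiff_self, E.empty'] at this
      exact this
  · rintro ⟨h3, h4⟩
    rw [h1, h2, h3, h4]

/-- Since `⟨E(A)x, y⟩ = ⟨E(A)x, E(A)y⟩`, Cauchy–Schwarz and `2ab ≤ a² + b²` give the bound set by
set. Consequently the complex measures have finite variation, and null sets need only be tested on
the positive measures `E.diag`. -/
theorem variation_assoc_le (x y : K) : (E.assoc x y).variation ≤ E.diag x + E.diag y := by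
  refine VectorMeasure.variation_le_of_forall_enorm_le fun A hA => ?_
  rw [assoc_apply, E.inner_apply hA, Measure.add_apply, E.diag_apply hA, E.diag_apply hA,
    ← ENNReal.ofReal_add (by positivity) (by positivity), ← ofReal_norm]
  refine ENNReal.ofReal_le_ofReal ((norm_inner_le_norm _ _).trans ?_)
  nlinarith [sq_nonneg (‖E A y‖ - ‖E A x‖), norm_nonneg (E A x), norm_nonneg (E A y)]

instance (x y : K) : IsFiniteMeasure (E.assoc x y).variation :=
  isFiniteMeasure_of_le _ (E.variation_assoc_le x y)

theorem ae_variation {p : X → Prop} (h : ∀ x, ∀ᵐ z ∂E.diag x, p z) (x y : K) :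
    ∀ᵐ z ∂(E.assoc x y).variation, p z :=
  (Measure.absolutelyContinuous_of_le (E.variation_assoc_le x y)).ae_le
    (ae_add_measure_iff.2 ⟨h x, h y⟩)

variable {f : X → ℂ}

/-- Measurable functions which are bounded outside a null set. -/
def EssBdd (f : X → ℂ) : Prop := Measurable f ∧ ∃ r : ℝ, 0 < r ∧ E {z | r ≤ ‖f z‖} = 0

variable {E}

/-- Cutting `f` off where it is large; identities for truly bounded functions then pass to
essentially bounded ones. -/
theorem EssBdd.exists_bddMeas (hf : E.EssBdd f) :
    ∃ g, BddMeas g ∧ ∀ ξ, f =ᵐ[E.diag ξ] g := by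
  obtain ⟨hm, r, hr, h0⟩ := hf
  have hA : MeasurableSet {z | r ≤ ‖f z‖} := measurableSet_le measurable_const hm.norm
  refine ⟨{z | r ≤ ‖f z‖}ᶜ.indicator f, ⟨hm.indicator hA.compl, r, fun z => ?_⟩, fun ξ => ?_⟩
  · by_cases hz : r ≤ ‖f z‖
    · simp [hz, hr.le]
    · simpa [hz] using (not_le.1 hz).le
  · have h1 := (E.eq_zero_iff hA).1 h0 ξ
    have h2 : ∀ᵐ z ∂E.diag ξ, z ∉ {z | r ≤ ‖f z‖} := measure_eq_zero_iff_ae_notMem.1 h1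
    filter_upwards [h2] with z hz
    exact (indicator_of_mem (show z ∈ {z | r ≤ ‖f z‖}ᶜ from hz) f).symm

theorem _root_.BddMeas.essBdd (hf : BddMeas f) : E.EssBdd f := by
  obtain ⟨C, hC⟩ := hf.2
  -- The extra 1 makes the radius positive and the set `{r ≤ |f|}` empty.
  refine ⟨hf.1, max C 0 + 1, by positivity, ?_⟩
  convert E.empty'
  ext z
  have h1 := hC z
  have h2 := le_max_left C 0
  simp only [mem_ofPred_eq, mem_empty_iff_false, iff_false, not_le]
  linarith

theorem EssBdd.ae_lt (hf : Measurable f) {r : ℝ} (h : E {z | r ≤ ‖f z‖} = 0) (ξ : K) :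
    ∀ᵐ z ∂E.diag ξ, ‖f z‖ < r := by
  have h1 := (E.eq_zero_iff (measurableSet_le measurable_const hf.norm)).1 h ξ
  filter_upwards [measure_eq_zero_iff_ae_notMem.1 h1] with z hz
  simpa using hz

theorem EssBdd.integrable_variation (hf : E.EssBdd f) (ξ η : K) :
    (E.assoc ξ η).Integrable f := by
  obtain ⟨g, hg, hfg⟩ := hf.exists_bddMeas
  exact (hg.integrable _).congr (EventuallyEq.symm (E.ae_variation hfg ξ η))

end Basic

end SpectralMeasure

/-! ### Integration of bounded functions against a complex spectral measure -/

namespace SpectralMeasure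

section Integral

variable {X : Type*} {m : MeasurableSpace X} {K : Type*}
  [NormedAddCommGroup K] [InnerProductSpace ℂ K] [CompleteSpace K] (E : SpectralMeasure m ℂ K)

/-- The form `(ξ, η) ↦ ∫ f d⟨E(·)ξ, η⟩`. -/
def form (f : X → ℂ) (ξ η : K) : ℂ := ∫ᵛ z, f z ∂[ContinuousLinearMap.mul ℝ ℂ; E.assoc ξ η]

theorem isBddIntegral_form (ξ η : K) : IsBddIntegral (fun f => E.form f ξ η) :=
  isBddIntegral_vectorMeasure _ _

theorem form_indicator {A : Set X} (hA : MeasurableSet A) (c : ℂ) (ξ η : K) :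
    E.form (A.indicator fun _ => c) ξ η = c * inner ℂ η (E A ξ) :=
  integral_indicator_const_vectorMeasure (E.assoc ξ η) (ContinuousLinearMap.mul ℝ ℂ) hA c

theorem form_congr {f g : X → ℂ} (h : ∀ ξ, f =ᵐ[E.diag ξ] g) (ξ η : K) :
    E.form f ξ η = E.form g ξ η :=
  VectorMeasure.integral_congr_ae (E.ae_variation h ξ η)

variable {f g : X → ℂ}

theorem form_add (hf : BddMeas f) (hg : BddMeas g) (ξ η : K) :
    E.form (f + g) ξ η = E.form f ξ η + E.form g ξ η :=
  (E.isBddIntegral_form ξ η).map_add f g hf hg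

theorem form_const_mul (hf : BddMeas f) (c : ℂ) (ξ η : K) :
    E.form (f * fun _ => c) ξ η = c * E.form f ξ η := by
  refine ((E.isBddIntegral_form ξ η).mul_left (BddMeas.const c)).ext
    ((E.isBddIntegral_form ξ η).const_mul c) (fun A d hA => ?_) hf
  have : (A.indicator (fun _ => d) * fun _ => c : X → ℂ) = A.indicator fun _ => d * c := by
    ext z
    by_cases hz : z ∈ A <;> simp [hz]
  rw [this, E.form_indicator hA, E.form_indicator hA]
  ring

theorem form_add_left (hf : BddMeas f) (ξ ξ' η : K) :
    E.form f (ξ + ξ') η = E.form f ξ η + E.form f ξ' η := by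
  refine (E.isBddIntegral_form _ η).ext
    ((E.isBddIntegral_form ξ η).add (E.isBddIntegral_form ξ' η)) (fun A c hA => ?_) hf
  simp only [E.form_indicator hA, _root_.map_add, inner_add_right]
  ring

theorem form_smul_left (hf : BddMeas f) (a : ℂ) (ξ η : K) :
    E.form f (a • ξ) η = a * E.form f ξ η := by
  refine (E.isBddIntegral_form _ η).ext
    ((E.isBddIntegral_form ξ η).const_mul a) (fun A c hA => ?_) hf
  simp only [E.form_indicator hA, _root_.map_smul, inner_smul_right]
  ring

theorem form_add_right (hf : BddMeas f) (ξ η η' : K) :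
    E.form f ξ (η + η') = E.form f ξ η + E.form f ξ η' := by
  refine (E.isBddIntegral_form ξ _).ext
    ((E.isBddIntegral_form ξ η).add (E.isBddIntegral_form ξ η')) (fun A c hA => ?_) hf
  simp only [E.form_indicator hA, inner_add_left]
  ring

theorem form_smul_right (hf : BddMeas f) (a : ℂ) (ξ η : K) :
    E.form f ξ (a • η) = conj a * E.form f ξ η := by
  refine (E.isBddIntegral_form ξ _).ext
    ((E.isBddIntegral_form ξ η).const_mul (conj a)) (fun A c hA => ?_) hf
  simp only [E.form_indicator hA, inner_smul_left]
  ring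

/-- On the indicator of `B` both sides reduce to `⟨E(A ∩ B)ξ, η⟩`. This is the first half of
multiplicativity, completed in `form_int`. -/
theorem form_apply_right (hf : BddMeas f) {A : Set X} (hA : MeasurableSet A) (ξ η : K) :
    E.form f ξ (E A η) = E.form (f * A.indicator fun _ => 1) ξ η := by
  refine (E.isBddIntegral_form ξ _).ext ((E.isBddIntegral_form ξ η).mul_left
    ((BddMeas.const 1).indicator hA)) (fun B c hB => ?_) hf
  have : (B.indicator (fun _ => c) * A.indicator fun _ => 1 : X → ℂ)
      = (A ∩ B).indicator fun _ => c := by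
    ext z
    by_cases hz : z ∈ A <;> by_cases hz' : z ∈ B <;> simp [hz, hz']
  rw [this, E.form_indicator (hA.inter hB), E.form_indicator hB, ← E.adjoint_apply hA,
    E.apply_apply hA hB]

theorem form_conj (hf : BddMeas f) (ξ η : K) :
    E.form (fun z => conj (f z)) ξ η = conj (E.form f η ξ) := by
  have := (E.isBddIntegral_form ξ η).conj_comp.ext
    (E.isBddIntegral_form η ξ) (fun A c hA => ?_) hf
  · rw [← this, Complex.conj_conj]
  · have : (fun z => conj (A.indicator (fun _ => c) z)) = A.indicator fun _ => conj c := by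
      ext z
      by_cases hz : z ∈ A <;> simp [hz]
    simp only [this, E.form_indicator hA, map_mul, Complex.conj_conj, inner_conj_symm]
    rw [E.adjoint_apply hA]

theorem form_self (hf : BddMeas f) (ξ : K) : E.form f ξ ξ = ∫ z, f z ∂E.diag ξ := by
  refine (E.isBddIntegral_form ξ ξ).ext (isBddIntegral_measure (E.diag ξ)) (fun A c hA => ?_) hf
  rw [E.form_indicator hA, E.inner_apply_self hA, integral_indicator_const c hA, E.diag_real hA,
    mul_comm]
  simp

theorem norm_form_le {C : ℝ} (hC : 0 ≤ C) (hf' : ∀ z, ‖f z‖ ≤ C) (ξ η : K) :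
    ‖E.form f ξ η‖ ≤ C * (‖ξ‖ ^ 2 + ‖η‖ ^ 2) := by
  refine (VectorMeasure.norm_integral_le_of_norm_le_const (Eventually.of_forall hf')).trans ?_
  have h1 : (E.assoc ξ η).variation.real univ ≤ ‖ξ‖ ^ 2 + ‖η‖ ^ 2 := by
    rw [← E.diag_real_univ, ← E.diag_real_univ, ← measureReal_add_apply]
    exact ENNReal.toReal_mono (by finiteness) (E.variation_assoc_le ξ η univ)
  have h2 : ‖ContinuousLinearMap.mul ℝ ℂ‖ ≤ 1 := ContinuousLinearMap.opNorm_mul_le ℝ ℂ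
  calc C * ‖ContinuousLinearMap.mul ℝ ℂ‖ * (E.assoc ξ η).variation.real univ
      ≤ C * 1 * (‖ξ‖ ^ 2 + ‖η‖ ^ 2) := by gcongr
    _ = _ := by ring

theorem exists_operator (hf : BddMeas f) :
    ∃ P : K →L[ℂ] K, ∀ ξ η, inner ℂ η (P ξ) = E.form f ξ η := by
  obtain ⟨C, hC⟩ := hf.2
  have hC' : ∀ z, ‖f z‖ ≤ max C 0 := fun z => (hC z).trans (le_max_left _ _)
  let b : K →ₗ⋆[ℂ] K →ₗ[ℂ] ℂ := LinearMap.mk₂'ₛₗ (starRingEnd ℂ) (RingHom.id ℂ)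
    (fun η ξ => E.form f ξ η) (fun η η' ξ => E.form_add_right hf ξ η η')
    (fun a η ξ => E.form_smul_right hf a ξ η) (fun η ξ ξ' => E.form_add_left hf ξ ξ' η)
    (fun a η ξ => E.form_smul_left hf a ξ η)
  have hb : ∀ η ξ, ‖b η ξ‖ ≤ (2 * max C 0) * ‖η‖ * ‖ξ‖ := by
    intro η ξ
    rcases eq_or_ne η 0 with rfl | hη
    · simp
    rcases eq_or_ne ξ 0 with rfl | hξ
    · simp
    have hη' := norm_pos_iff.2 hη
    have hξ' := norm_pos_iff.2 hξ
    -- The available bound is a sum of squares; normalising both vectors turns it into a product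
    -- bound with constant `2 max C 0`.
    have h := E.norm_form_le (le_max_right _ _) hC' ((‖ξ‖⁻¹ : ℂ) • ξ) ((‖η‖⁻¹ : ℂ) • η)
    rw [E.form_smul_left hf, E.form_smul_right hf, norm_mul, norm_mul, norm_smul, norm_smul] at h
    simp only [norm_inv, Complex.norm_real, norm_norm, RCLike.norm_conj] at h
    rw [inv_mul_cancel₀ hη'.ne', inv_mul_cancel₀ hξ'.ne'] at h
    change ‖E.form f ξ η‖ ≤ _
    have h3 : ‖E.form f ξ η‖ = ‖η‖ * ‖ξ‖ * (‖ξ‖⁻¹ * (‖η‖⁻¹ * ‖E.form f ξ η‖)) := by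
      field_simp
    rw [h3]
    calc _ ≤ ‖η‖ * ‖ξ‖ * (max C 0 * (1 ^ 2 + 1 ^ 2)) := by gcongr
      _ = _ := by ring
  let B : K →L⋆[ℂ] K →L[ℂ] ℂ := LinearMap.mkContinuous₂ b _ hb
  -- `B` is conjugate-linear in `η`, its first variable, so the operator representing it acts on
  -- `η`; the adjoint moves it to `ξ`.
  refine ⟨ContinuousLinearMap.adjoint (InnerProductSpace.continuousLinearMapOfBilin B),
    fun ξ η => ?_⟩
  rw [ContinuousLinearMap.adjoint_inner_right,
    InnerProductSpace.continuousLinearMapOfBilin_apply]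
  rfl

open Classical in
/-- The operator `∫ f dE`, determined by `⟨(∫ f dE)ξ, η⟩ = ∫ f d⟨E(·)ξ, η⟩`. -/
def int (f : X → ℂ) : K →L[ℂ] K :=
  if h : ∃ P : K →L[ℂ] K, ∀ ξ η, inner ℂ η (P ξ) = E.form f ξ η then h.choose else 0

theorem int_congr (h : ∀ ξ, f =ᵐ[E.diag ξ] g) : E.int f = E.int g := by
  have h' : E.form f = E.form g := funext fun ξ => funext fun η => E.form_congr h ξ η
  unfold int
  rw [h']

variable {E}

theorem inner_int (hf : E.EssBdd f) (ξ η : K) : inner ℂ η (E.int f ξ) = E.form f ξ η := by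
  obtain ⟨g, hg, hfg⟩ := hf.exists_bddMeas
  obtain ⟨P, hP⟩ := E.exists_operator hg
  have h : ∃ P : K →L[ℂ] K, ∀ ξ η, inner ℂ η (P ξ) = E.form f ξ η :=
    ⟨P, fun ξ η => by rw [hP, E.form_congr hfg]⟩
  rw [int, dif_pos h]
  exact h.choose_spec ξ η

theorem int_eq_of_inner (hf : E.EssBdd f) {P : K →L[ℂ] K}
    (h : ∀ ξ η, inner ℂ η (P ξ) = E.form f ξ η) : E.int f = P := by
  ext ξ
  refine ext_inner_left ℂ fun η => ?_
  rw [inner_int hf, h]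

theorem int_indicator {A : Set X} (hA : MeasurableSet A) :
    E.int (A.indicator fun _ => 1) = E A :=
  int_eq_of_inner ((BddMeas.const 1).indicator hA).essBdd fun ξ η => by
    rw [E.form_indicator hA, one_mul]

theorem int_const (c : ℂ) : E.int (fun _ => c) = c • 1 := by
  refine int_eq_of_inner (BddMeas.const c).essBdd fun ξ η => ?_
  have := E.form_indicator MeasurableSet.univ c ξ η
  rw [indicator_univ, E.univ'] at this
  rw [this, _root_.smul_apply, inner_smul_right]

theorem int_add (hf : E.EssBdd f) (hg : E.EssBdd g) : E.int (f + g) = E.int f + E.int g := by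
  obtain ⟨f', hf', hff'⟩ := hf.exists_bddMeas
  obtain ⟨g', hg', hgg'⟩ := hg.exists_bddMeas
  rw [E.int_congr hff', E.int_congr hgg', E.int_congr fun ξ => (hff' ξ).add (hgg' ξ)]
  refine int_eq_of_inner (hf'.add hg').essBdd fun ξ η => ?_
  rw [E.form_add hf' hg', _root_.add_apply, inner_add_right, inner_int hf'.essBdd,
    inner_int hg'.essBdd]

/-- For `f` an indicator of `A`, the projection `E(A)` moves to the right-hand vector and is then
absorbed into the integrand of `g` by `form_apply_right`. -/
theorem form_int (hf : BddMeas f) (hg : BddMeas g) (ξ η : K) :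
    E.form f (E.int g ξ) η = E.form (f * g) ξ η := by
  refine (E.isBddIntegral_form _ η).ext ((E.isBddIntegral_form ξ η).mul_left hg)
    (fun A c hA => ?_) hf
  have : (A.indicator (fun _ => c) * g : X → ℂ) = (g * A.indicator fun _ => 1) * fun _ => c := by
    ext z
    by_cases hz : z ∈ A <;> simp [hz, mul_comm]
  rw [this, E.form_const_mul (hg.mul ((BddMeas.const 1).indicator hA)), E.form_indicator hA,
    E.adjoint_apply hA, inner_int hg.essBdd, E.form_apply_right hg hA]

theorem int_mul (hf : E.EssBdd f) (hg : E.EssBdd g) : E.int (f * g) = E.int f * E.int g := by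
  obtain ⟨f', hf', hff'⟩ := hf.exists_bddMeas
  obtain ⟨g', hg', hgg'⟩ := hg.exists_bddMeas
  rw [E.int_congr hff', E.int_congr hgg', E.int_congr fun ξ => (hff' ξ).mul (hgg' ξ)]
  refine int_eq_of_inner (hf'.mul hg').essBdd fun ξ η => ?_
  rw [mul_apply_eq_comp, inner_int hf'.essBdd, form_int hf' hg']

theorem int_conj (hf : E.EssBdd f) :
    E.int (fun z => conj (f z)) = ContinuousLinearMap.adjoint (E.int f) := by
  obtain ⟨f', hf', hff'⟩ := hf.exists_bddMeas
  have h : ∀ ξ, (fun z => conj (f z)) =ᵐ[E.diag ξ] fun z => conj (f' z) := fun ξ => by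
    filter_upwards [hff' ξ] with z hz
    rw [hz]
  rw [E.int_congr hff', E.int_congr h]
  refine int_eq_of_inner hf'.conj_comp.essBdd fun ξ η => ?_
  rw [ContinuousLinearMap.adjoint_inner_right, E.form_conj hf', ← inner_int hf'.essBdd,
    inner_conj_symm]

/-- The adjoint and product rules turn the square into `⟨(∫ f̄f dE)ξ, ξ⟩`, an integral against the
diagonal measure. Both the norm formula and the mean square approximation rest on this. -/
theorem norm_int_sq (hf : E.EssBdd f) (ξ : K) :
    ‖E.int f ξ‖ ^ 2 = ∫ z, ‖f z‖ ^ 2 ∂E.diag ξ := by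
  obtain ⟨f', hf', hff'⟩ := hf.exists_bddMeas
  have h : (fun z => ‖f z‖ ^ 2) =ᵐ[E.diag ξ] fun z => ‖f' z‖ ^ 2 := by
    filter_upwards [hff' ξ] with z hz
    rw [hz]
  rw [E.int_congr hff', integral_congr_ae h]
  have h1 : inner ℂ (E.int f' ξ) (E.int f' ξ) = ((∫ z, ‖f' z‖ ^ 2 ∂E.diag ξ : ℝ) : ℂ) := by
    rw [← ContinuousLinearMap.adjoint_inner_right, ← int_conj hf'.essBdd,
      ← mul_apply_eq_comp, ← int_mul hf'.conj_comp.essBdd hf'.essBdd,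
      inner_int (hf'.conj_comp.mul hf').essBdd, form_self _ (hf'.conj_comp.mul hf'),
      ← integral_complex_ofReal]
    congr 1
    ext z
    rw [Pi.mul_apply, Complex.conj_mul']
    simp
  rw [inner_self_eq_norm_sq_to_K] at h1
  exact Complex.ofReal_injective (by simpa using h1)

theorem EssBdd.const_mul (hf : E.EssBdd f) (c : ℂ) : E.EssBdd ((fun _ => c) * f) := by
  obtain ⟨hf, r, hr, hr'⟩ := hf
  have h1 := measurableSet_le (measurable_const (a := r)) hf.norm
  have h2 : Measurable ((fun _ => c) * f) := measurable_const.mul hf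
  -- Adding 1 keeps the radius positive when `c = 0`.
  refine ⟨h2, (‖c‖ + 1) * r, by positivity, E.null_mono
    (measurableSet_le measurable_const h2.norm) h1 (fun z hz => ?_) hr'⟩
  simp only [mem_ofPred_eq, Pi.mul_apply, norm_mul] at hz ⊢
  by_contra hc
  nlinarith [norm_nonneg c, norm_nonneg (f z)]

theorem int_sub (hf : E.EssBdd f) (hg : E.EssBdd g) : E.int (f - g) = E.int f - E.int g := by
  have h : f - g = f + (fun _ => (-1 : ℂ)) * g := by ext z; simp [sub_eq_add_neg]
  rw [h, int_add hf (hg.const_mul _), int_mul (BddMeas.const _).essBdd hg, int_const]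
  simp [sub_eq_add_neg]

/-- `‖∫ f dE‖` is the essential supremum of `|f|`. -/
theorem norm_int (hf : E.EssBdd f) :
    ‖E.int f‖ = sInf {r : ℝ | 0 < r ∧ E {z | r ≤ ‖f z‖} = 0} := by
  have hbdd : BddBelow {r : ℝ | 0 < r ∧ E {z | r ≤ ‖f z‖} = 0} := ⟨0, fun r hr => hr.1.le⟩
  apply le_antisymm
  · refine le_csInf hf.2 fun r hr => ?_
    refine ContinuousLinearMap.opNorm_le_bound _ hr.1.le fun ξ => ?_
    refine abs_le_of_sq_le_sq' ?_ (by have := hr.1; positivity) |>.2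
    rw [norm_int_sq hf]
    calc ∫ z, ‖f z‖ ^ 2 ∂E.diag ξ ≤ ∫ z, r ^ 2 ∂E.diag ξ := by
          refine integral_mono_of_nonneg (Eventually.of_forall fun z => by positivity)
            (integrable_const _) ?_
          filter_upwards [EssBdd.ae_lt hf.1 hr.2 ξ] with z hz
          gcongr
      _ = (r * ‖ξ‖) ^ 2 := by
          rw [integral_const, E.diag_real_univ, smul_eq_mul]
          ring
  · refine le_of_forall_gt_imp_ge_of_dense fun r hr => csInf_le hbdd ?_
    have hr0 : 0 < r := (norm_nonneg _).trans_lt hr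
    have hA : MeasurableSet {z | r ≤ ‖f z‖} := measurableSet_le measurable_const hf.1.norm
    refine ⟨hr0, ?_⟩
    ext x
    set ξ := E {z | r ≤ ‖f z‖} x with hξ
    have hξξ : E {z | r ≤ ‖f z‖} ξ = ξ := E.apply_self hA x
    have hae : ∀ᵐ z ∂E.diag ξ, r ≤ ‖f z‖ := by
      have : E.diag ξ {z | r ≤ ‖f z‖}ᶜ = 0 := by
        rw [E.diag_eq_zero hA.compl, E.apply_compl hA, _root_.sub_apply, hξξ]
        simp
      filter_upwards [measure_eq_zero_iff_ae_notMem.1 this] with z hz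
      simpa using hz
    have h1 : (r * ‖ξ‖) ^ 2 ≤ ‖E.int f ξ‖ ^ 2 := by
      rw [norm_int_sq hf]
      calc (r * ‖ξ‖) ^ 2 = ∫ z, r ^ 2 ∂E.diag ξ := by
            rw [integral_const, E.diag_real_univ, smul_eq_mul]
            ring
        _ ≤ _ := by
          refine integral_mono_ae (integrable_const _) ?_ ?_
          · obtain ⟨s, hs, hs'⟩ := hf.2
            refine Integrable.of_bound (hf.1.norm.pow_const 2).aestronglyMeasurable (s ^ 2) ?_
            filter_upwards [EssBdd.ae_lt hf.1 hs' ξ] with z hz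
            rw [norm_pow, norm_norm]
            gcongr
          · filter_upwards [hae] with z hz
            gcongr
    have h2 := (abs_le_of_sq_le_sq' h1 (norm_nonneg _)).2.trans ((E.int f).le_opNorm ξ)
    by_contra hne
    have h3 : 0 < ‖ξ‖ := norm_pos_iff.2 hne
    nlinarith

end Integral

end SpectralMeasure

/-! ### Approximation in mean square by continuous functions -/

section Approximation

theorem BddMeas.memLp {X : Type*} [MeasurableSpace X] {f : X → ℂ} (hf : BddMeas f)
    (μ : Measure X) [IsFiniteMeasure μ] : MemLp f 2 μ := by
  obtain ⟨C, hC⟩ := hf.2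
  exact MemLp.of_bound hf.1.aestronglyMeasurable C (Eventually.of_forall hC)

/-- Puts isometry statements in extended-norm form, so that later limit arguments run entirely in
`ℝ≥0∞`. -/
theorem enorm_eq_eLpNorm_two {X K : Type*} [MeasurableSpace X] [NormedAddCommGroup K]
    {μ : Measure X} [IsFiniteMeasure μ] {f : X → ℂ} (hf : BddMeas f) {v : K}
    (h : ‖v‖ ^ 2 = ∫ z, ‖f z‖ ^ 2 ∂μ) : ‖v‖ₑ = eLpNorm f 2 μ := by
  rw [(hf.memLp μ).eLpNorm_eq_integral_rpow_norm two_ne_zero ENNReal.ofNat_ne_top,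
    ← ofReal_norm]
  congr 1
  simp only [ENNReal.toReal_ofNat, Real.rpow_two]
  rw [← h, ← Real.rpow_two, ← Real.rpow_mul (norm_nonneg _)]
  norm_num

/-- Later `μ` is often a sum of measures attached to several vectors: one sequence then approximates
`f` for all of them at once, by `tendsto_eLpNorm_of_le`. -/
theorem exists_continuousMap_tendsto_eLpNorm {X : Type*} [MetricSpace X] [CompactSpace X]
    [MeasurableSpace X] [BorelSpace X] {f : X → ℂ} (hf : BddMeas f) (μ : Measure X)
    [IsFiniteMeasure μ] :
    ∃ g : ℕ → C(X, ℂ), Tendsto (fun n => eLpNorm (f - ⇑(g n)) 2 μ) atTop (𝓝 0) := by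
  obtain ⟨u, -, hu, hu0⟩ := exists_seq_strictAnti_tendsto' (α := ℝ≥0∞) (x := 0) (y := 1) one_pos
  choose g hg _ using fun n => (hf.memLp μ).exists_boundedContinuous_eLpNorm_sub_le
    ENNReal.ofNat_ne_top (hu n).1.ne'
  exact ⟨fun n => (g n).toContinuousMap,
    tendsto_of_tendsto_of_tendsto_of_le_of_le tendsto_const_nhds hu0 (fun _ => zero_le) hg⟩

theorem tendsto_eLpNorm_of_le {X : Type*} [MeasurableSpace X] {μ ν : Measure X} (h : μ ≤ ν)
    {F : ℕ → X → ℂ} (hF : Tendsto (fun n => eLpNorm (F n) 2 ν) atTop (𝓝 0)) :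
    Tendsto (fun n => eLpNorm (F n) 2 μ) atTop (𝓝 0) :=
  tendsto_of_tendsto_of_tendsto_of_le_of_le tendsto_const_nhds hF (fun _ => zero_le)
    fun n => eLpNorm_mono_measure (F n) h

theorem BddMeas.eLpNorm_triangle {X : Type*} [MeasurableSpace X] {f g h : X → ℂ} (hf : BddMeas f) (hg : BddMeas g)
    (hh : BddMeas h) (μ : Measure X) :
    eLpNorm (f - h) 2 μ ≤ eLpNorm (f - g) 2 μ + eLpNorm (g - h) 2 μ := by
  rw [← sub_add_sub_cancel f g h]
  exact eLpNorm_add_le (hf.sub hg).1.aestronglyMeasurable (hg.sub hh).1.aestronglyMeasurable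
    one_le_two

theorem tendsto_eLpNorm_mul {X : Type*} [MeasurableSpace X] {f g : X → ℂ}
    {F : ℕ → X → ℂ} (hg : BddMeas g) {μ : Measure X}
    (h : Tendsto (fun n => eLpNorm (f - F n) 2 μ) atTop (𝓝 0)) :
    Tendsto (fun n => eLpNorm (g * f - g * F n) 2 μ) atTop (𝓝 0) := by
  obtain ⟨C, hC⟩ := hg.2
  have h0 := ENNReal.Tendsto.const_mul (a := ENNReal.ofReal C) h (Or.inr ENNReal.ofReal_ne_top)
  rw [mul_zero] at h0
  refine tendsto_of_tendsto_of_tendsto_of_le_of_le tendsto_const_nhds h0 (fun _ => zero_le)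
    fun n => ?_
  refine eLpNorm_le_mul_eLpNorm_of_ae_le_mul (Eventually.of_forall fun z => ?_) 2
  simp only [Pi.sub_apply, Pi.mul_apply]
  rw [← mul_sub, norm_mul]
  gcongr
  exact hC z

theorem tendsto_of_enorm_sub_le {K : Type*} [NormedAddCommGroup K] {v : K} {u : ℕ → K}
    {a : ℕ → ℝ≥0∞} (ha : Tendsto a atTop (𝓝 0)) (h : ∀ n, ‖v - u n‖ₑ ≤ a n) :
    Tendsto u atTop (𝓝 v) := by
  rw [tendsto_iff_edist_tendsto_0]
  refine tendsto_of_tendsto_of_tendsto_of_le_of_le tendsto_const_nhds ha (fun _ => zero_le)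
    fun n => ?_
  rw [edist_comm, edist_eq_enorm_sub]
  exact h n

end Approximation

/-! ### Uniqueness and commutation, reduced to continuous functions -/

namespace SpectralMeasure

section Continuous

variable {X : Type*} [MetricSpace X] [CompactSpace X] [m : MeasurableSpace X] [BorelSpace X]
  {K : Type*} [NormedAddCommGroup K] [InnerProductSpace ℂ K] [CompleteSpace K]
  {E : SpectralMeasure m ℂ K}

theorem tendsto_int {f : X → ℂ} (hf : BddMeas f) {g : ℕ → C(X, ℂ)} {ξ : K}
    (h : Tendsto (fun n => eLpNorm (f - ⇑(g n)) 2 (E.diag ξ)) atTop (𝓝 0)) :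
    Tendsto (fun n => E.int (g n) ξ) atTop (𝓝 (E.int f ξ)) := by
  refine tendsto_of_enorm_sub_le h fun n => ?_
  have hb := hf.sub (BddMeas.of_continuous (g n))
  have := enorm_eq_eLpNorm_two hb (norm_int_sq (E := E) hb.essBdd ξ)
  rw [int_sub hf.essBdd (BddMeas.of_continuous (g n)).essBdd] at this
  exact this.le

variable (E) in
/-- The restriction of `f ↦ ∫ f dE` to continuous functions. -/
def continuousHom : C(X, ℂ) →⋆ₐ[ℂ] (K →L[ℂ] K) where
  toFun g := E.int g
  map_one' := (int_const (E := E) 1).trans (one_smul ℂ 1)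
  map_mul' f g := int_mul (BddMeas.of_continuous f).essBdd (BddMeas.of_continuous g).essBdd
  map_zero' := (int_const (E := E) 0).trans (zero_smul ℂ 1)
  map_add' f g := int_add (BddMeas.of_continuous f).essBdd (BddMeas.of_continuous g).essBdd
  commutes' c := (int_const c).trans (Algebra.algebraMap_eq_smul_one c).symm
  map_star' f := int_conj (BddMeas.of_continuous f).essBdd

/-- An indicator is approximated by one sequence of continuous functions in mean square for both
diagonal measures at `ξ`; the two vector limits are limits of the same sequence. -/
theorem ext_of_continuousHom {E F : SpectralMeasure m ℂ K}
    (h : E.continuousHom = F.continuousHom) : E = F := by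
  ext A : 2
  by_cases hA : MeasurableSet A
  · have hb := (BddMeas.const 1).indicator hA
    ext ξ
    obtain ⟨g, hg⟩ := exists_continuousMap_tendsto_eLpNorm hb (E.diag ξ + F.diag ξ)
    have h1 := tendsto_int (E := E) hb (tendsto_eLpNorm_of_le (Measure.le_add_right le_rfl) hg)
    have h2 := tendsto_int (E := F) hb (tendsto_eLpNorm_of_le (Measure.le_add_left le_rfl) hg)
    have h3 : ∀ n, E.int (g n) = F.int (g n) := fun n => DFunLike.congr_fun h (g n)
    simp only [h3] at h1
    have := tendsto_nhds_unique h1 h2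
    rwa [int_indicator hA, int_indicator hA] at this
  · rw [E.not_measurable' A hA, F.not_measurable' A hA]

/-- The same approximation, carried out simultaneously for the measures of `ξ` and of `R ξ`. -/
theorem commute_of_continuousHom {R : K →L[ℂ] K}
    (h : ∀ g : C(X, ℂ), Commute R (E.continuousHom g)) {A : Set X} (hA : MeasurableSet A) :
    Commute R (E A) := by
  have hb := (BddMeas.const 1).indicator hA
  ext ξ
  obtain ⟨g, hg⟩ := exists_continuousMap_tendsto_eLpNorm hb (E.diag ξ + E.diag (R ξ))
  have h1 := tendsto_int (E := E) hb (tendsto_eLpNorm_of_le (Measure.le_add_right le_rfl) hg)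
  have h2 := tendsto_int (E := E) hb (tendsto_eLpNorm_of_le (Measure.le_add_left le_rfl) hg)
  have h3 : ∀ n, R (E.int (g n) ξ) = E.int (g n) (R ξ) := fun n =>
    DFunLike.congr_fun (h (g n)) ξ
  have h4 := (R.continuous.tendsto _).comp h1
  simp only [comp_def, h3] at h4
  have := tendsto_nhds_unique h4 h2
  rwa [int_indicator hA] at this

end Continuous

section Operator

variable {K : Type*} [NormedAddCommGroup K] [InnerProductSpace ℂ K] [CompleteSpace K]
  {S : K →L[ℂ] K}
  {E : SpectralMeasure (Subtype.instMeasurableSpace : MeasurableSpace (spectrum ℂ S)) ℂ K}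

theorem IsSpectralMeasureOf.int_id (hE : E.IsSpectralMeasureOf S) :
    E.int (fun z => (z : ℂ)) = S :=
  int_eq_of_inner (BddMeas.of_continuous
    ((ContinuousMap.id ℂ).restrict (spectrum ℂ S))).essBdd fun ξ η => hE ξ η

/-- A continuous star morphism on `C(σ(S), ℂ)` is determined by the image of the identity function,
and star morphisms between C⋆-algebras are automatically contractive. -/
theorem IsSpectralMeasureOf.continuousHom_eq (hS : IsStarNormal S)
    (hE : E.IsSpectralMeasureOf S) : cfcHom hS = E.continuousHom :=
  cfcHom_eq_of_continuous_of_map_id hS _ (AddMonoidHomClass.continuous_of_bound E.continuousHom 1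
    fun g => by simpa using NonUnitalStarAlgHom.norm_apply_le E.continuousHom g) hE.int_id

theorem IsSpectralMeasureOf.unique (hS : IsStarNormal S)
    {F : SpectralMeasure (Subtype.instMeasurableSpace : MeasurableSpace (spectrum ℂ S)) ℂ K}
    (hE : E.IsSpectralMeasureOf S) (hF : F.IsSpectralMeasureOf S) : E = F :=
  ext_of_continuousHom ((hE.continuousHom_eq hS).symm.trans (hF.continuousHom_eq hS))

/-- Fuglede's theorem: commuting with the normal operator `S` implies commuting with its adjoint,
hence with the whole continuous calculus. -/
theorem IsSpectralMeasureOf.commute (hS : IsStarNormal S) (hE : E.IsSpectralMeasureOf S)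
    {R : K →L[ℂ] K} (hR : Commute R S) {A : Set (spectrum ℂ S)} (hA : MeasurableSet A) :
    Commute R (E A) := by
  refine commute_of_continuousHom (fun g => ?_) hA
  rw [← hE.continuousHom_eq hS]
  exact (Commute.cfcHom hS hR.symm (hS.commute_star_right hR).symm g).symm

end Operator

end SpectralMeasure

/-! ### The spectral measure of a representation of `C(X, ℂ)` -/

section Existence

open scoped CompactlySupported

variable {X : Type*} [MetricSpace X] [CompactSpace X] [m : MeasurableSpace X] [BorelSpace X]
  {K : Type*} [NormedAddCommGroup K] [InnerProductSpace ℂ K] [CompleteSpace K]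
  (ρ : C(X, ℂ) →⋆ₐ[ℂ] (K →L[ℂ] K))

theorem inner_rep_self (g : C(X, ℂ)) (ξ : K) :
    inner ℂ ξ (ρ (star g * g) ξ) = ((‖ρ g ξ‖ ^ 2 : ℝ) : ℂ) := by
  rw [map_mul, map_star, mul_apply_eq_comp, ContinuousLinearMap.star_eq_adjoint,
    ContinuousLinearMap.adjoint_inner_right, inner_self_eq_norm_sq_to_K]
  simp

/-- The complex continuous function underlying a real one. -/
def complexify (f : C(X, ℝ)) : C(X, ℂ) := ⟨fun z => (f z : ℂ), by fun_prop⟩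

theorem star_complexify (f : C(X, ℝ)) : star (complexify f) = complexify f := by
  ext z; simp [complexify]

/-- A real function is sent to a self-adjoint operator. -/
theorem inner_rep_complexify (f : C(X, ℝ)) (ξ : K) :
    inner ℂ ξ (ρ (complexify f) ξ) = ((inner ℂ ξ (ρ (complexify f) ξ)).re : ℂ) := by
  refine (Complex.conj_eq_iff_re.1 ?_).symm
  rw [inner_conj_symm, ← ContinuousLinearMap.adjoint_inner_right,
    ← ContinuousLinearMap.star_eq_adjoint, ← map_star, star_complexify]

/-- The positive functional `f ↦ ⟨ρ(f)ξ, ξ⟩`. -/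
def repFunctional (ξ : K) : C_c(X, ℝ) →ₚ[ℝ] ℝ where
  toFun f := (inner ℂ ξ (ρ (complexify (f : C(X, ℝ))) ξ)).re
  map_add' f g := by
    have : complexify ((f + g : C_c(X, ℝ)) : C(X, ℝ))
        = complexify (f : C(X, ℝ)) + complexify (g : C(X, ℝ)) := by
      ext z; simp [complexify]
    rw [this, map_add, add_apply, inner_add_right, Complex.add_re]
  map_smul' c f := by
    have : complexify ((c • f : C_c(X, ℝ)) : C(X, ℝ))
        = (c : ℂ) • complexify (f : C(X, ℝ)) := by
      ext z; simp [complexify]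
    rw [this, map_smul, smul_apply, inner_smul_right, Complex.re_ofReal_mul]
    rfl
  monotone' f g hfg := by
    -- Positivity: with `h` the continuous square root of `g - f`, the increment is `ρ(h)*ρ(h)`.
    let h : C(X, ℝ) := ⟨fun z => √(g z - f z), by fun_prop⟩
    have : complexify (g : C(X, ℝ))
        = complexify (f : C(X, ℝ)) + star (complexify h) * complexify h := by
      ext z
      have hz : √(g z - f z) * √(g z - f z) = g z - f z := Real.mul_self_sqrt (sub_nonneg.2 (hfg z))
      rw [star_complexify]
      simp only [complexify, ContinuousMap.coe_mk, ContinuousMap.add_apply, ContinuousMap.mul_apply,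
        h]
      rw [← Complex.ofReal_mul, hz]
      simp
    simp only
    rw [this, map_add, add_apply, inner_add_right, Complex.add_re, inner_rep_self]
    rw [Complex.ofReal_re]
    exact le_add_of_nonneg_right (sq_nonneg _)

theorem exists_rep_measure (ξ : K) : ∃ μ : Measure X, IsFiniteMeasure μ ∧
    ∀ g : C(X, ℂ), ∫ z, g z ∂μ = inner ℂ ξ (ρ g ξ) := by
  refine ⟨RealRMK.rieszMeasure (repFunctional ρ ξ), inferInstance, fun g => ?_⟩
  set μ := RealRMK.rieszMeasure (repFunctional ρ ξ)
  have hreal : ∀ f : C(X, ℝ), ∫ z, complexify f z ∂μ = inner ℂ ξ (ρ (complexify f) ξ) := by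
    intro f
    have := RealRMK.integral_rieszMeasure (repFunctional ρ ξ)
      ⟨f, HasCompactSupport.of_compactSpace f⟩
    rw [inner_rep_complexify]
    exact integral_complex_ofReal.trans (congrArg Complex.ofReal this)
  let g₁ : C(X, ℝ) := ⟨fun z => (g z).re, by fun_prop⟩
  let g₂ : C(X, ℝ) := ⟨fun z => (g z).im, by fun_prop⟩
  have hg : g = complexify g₁ + Complex.I • complexify g₂ := by
    ext z
    simp only [complexify, ContinuousMap.add_apply, ContinuousMap.smul_apply, ContinuousMap.coe_mk,
      g₁, g₂, smul_eq_mul]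
    rw [mul_comm, Complex.re_add_im]
  have hint : ∀ f : C(X, ℂ), Integrable f μ := fun f => (BddMeas.of_continuous f).integrable μ
  rw [hg, map_add, map_smul, add_apply, smul_apply, inner_add_right, inner_smul_right,
    ← hreal, ← hreal, ← integral_const_mul,
    ← integral_add (hint _) ((hint _).const_mul _)]
  rfl

/-- A measure representing `f ↦ ⟨ρ(f)ξ, ξ⟩`. -/
def repMeasure (ξ : K) : Measure X := (exists_rep_measure ρ ξ).choose

instance (ξ : K) : IsFiniteMeasure (repMeasure ρ ξ) := (exists_rep_measure ρ ξ).choose_spec.1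

theorem integral_repMeasure (ξ : K) (g : C(X, ℂ)) :
    ∫ z, g z ∂repMeasure ρ ξ = inner ℂ ξ (ρ g ξ) := (exists_rep_measure ρ ξ).choose_spec.2 g

/-- The isometry behind the extension to Borel functions: apply the representing measure to `ḡg`. -/
theorem enorm_rep (g : C(X, ℂ)) (ξ : K) : ‖ρ g ξ‖ₑ = eLpNorm g 2 (repMeasure ρ ξ) := by
  refine enorm_eq_eLpNorm_two (BddMeas.of_continuous g) ?_
  have h := integral_repMeasure ρ ξ (star g * g)
  rw [inner_rep_self] at h
  apply Complex.ofReal_injective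
  rw [← h, ← integral_complex_ofReal]
  congr 1
  ext z
  simp [Complex.conj_mul']

/-- `v` is the mean square limit of the vectors `ρ(g)ξ` as the continuous function `g` tends to
`f` in mean square. -/
def IsRepLimit (f : X → ℂ) (ξ v : K) : Prop :=
  ∀ g : C(X, ℂ), ‖v - ρ g ξ‖ₑ ≤ eLpNorm (f - ⇑g) 2 (repMeasure ρ ξ)

variable {ρ}

theorem isRepLimit_continuous (g : C(X, ℂ)) (ξ : K) : IsRepLimit ρ g ξ (ρ g ξ) := by
  intro h
  rw [← sub_apply, ← map_sub, enorm_rep]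
  rfl

namespace IsRepLimit

variable {f : X → ℂ} {ξ v w : K}

theorem tendsto (h : IsRepLimit ρ f ξ v) {g : ℕ → C(X, ℂ)}
    (hg : Tendsto (fun n => eLpNorm (f - ⇑(g n)) 2 (repMeasure ρ ξ)) atTop (𝓝 0)) :
    Tendsto (fun n => ρ (g n) ξ) atTop (𝓝 v) :=
  tendsto_of_enorm_sub_le hg fun n => h (g n)

/-- Both sides of the defining inequality are continuous for these limits, so the relation is
closed; this is how every new instance of it is produced below. -/
theorem of_tendsto (hf : BddMeas f) {F : ℕ → X → ℂ} (hF : ∀ n, BddMeas (F n)) {u : ℕ → K}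
    (h : ∀ n, IsRepLimit ρ (F n) ξ (u n))
    (hFf : Tendsto (fun n => eLpNorm (f - F n) 2 (repMeasure ρ ξ)) atTop (𝓝 0))
    (hu : Tendsto u atTop (𝓝 v)) : IsRepLimit ρ f ξ v := by
  intro g
  have hu' : Tendsto (fun n => ‖v - u n‖ₑ) atTop (𝓝 0) := by
    have := (tendsto_const_nhds (x := v)).sub hu
    rw [sub_self] at this
    simpa using this.enorm
  have hlim := (hu'.add hFf).add_const (eLpNorm (f - ⇑g) 2 (repMeasure ρ ξ))
  rw [add_zero, zero_add] at hlim
  refine ge_of_tendsto' hlim fun n => ?_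
  calc ‖v - ρ g ξ‖ₑ = ‖(v - u n) + (u n - ρ g ξ)‖ₑ := by rw [sub_add_sub_cancel]
    _ ≤ ‖v - u n‖ₑ + ‖u n - ρ g ξ‖ₑ := enorm_add_le _ _
    _ ≤ ‖v - u n‖ₑ + (eLpNorm (f - F n) 2 (repMeasure ρ ξ)
          + eLpNorm (f - ⇑g) 2 (repMeasure ρ ξ)) := by
      gcongr
      refine (h n g).trans (((hF n).eLpNorm_triangle hf (BddMeas.of_continuous g) _).trans ?_)
      rw [eLpNorm_sub_comm]
    _ = _ := by rw [add_assoc]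

theorem exists_of_bddMeas (hf : BddMeas f) (ξ : K) : ∃ v, IsRepLimit ρ f ξ v := by
  obtain ⟨g, hg⟩ := exists_continuousMap_tendsto_eLpNorm hf (repMeasure ρ ξ)
  -- By the isometry, mean square Cauchy functions give Cauchy vectors.
  have hc : CauchySeq fun n => ρ (g n) ξ := by
    refine EMetric.cauchySeq_iff.2 fun ε hε => ?_
    have hε' : (0 : ℝ≥0∞) < ε / 2 := ENNReal.half_pos hε.ne'
    obtain ⟨N, hN⟩ := eventually_atTop.1 (hg.eventually (gt_mem_nhds hε'))
    refine ⟨N, fun n hn k hk => ?_⟩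
    rw [edist_eq_enorm_sub, ← sub_apply, ← map_sub, enorm_rep]
    refine ((BddMeas.of_continuous (g n)).eLpNorm_triangle hf
      (BddMeas.of_continuous (g k)) _).trans_lt ?_
    rw [eLpNorm_sub_comm, ← ENNReal.add_halves ε]
    exact ENNReal.add_lt_add (hN n hn) (hN k hk)
  obtain ⟨v, hv⟩ := cauchySeq_tendsto_of_complete hc
  exact ⟨v, of_tendsto hf (fun n => BddMeas.of_continuous (g n))
    (fun n => isRepLimit_continuous (g n) ξ) hg hv⟩

theorem unique (hf : BddMeas f) (h : IsRepLimit ρ f ξ v) (h' : IsRepLimit ρ f ξ w) : v = w := by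
  obtain ⟨g, hg⟩ := exists_continuousMap_tendsto_eLpNorm hf (repMeasure ρ ξ)
  exact tendsto_nhds_unique (h.tendsto hg) (h'.tendsto hg)

theorem enorm_eq (hf : BddMeas f) (h : IsRepLimit ρ f ξ v) :
    ‖v‖ₑ = eLpNorm f 2 (repMeasure ρ ξ) := by
  apply le_antisymm
  · have := h 0
    rwa [map_zero, zero_apply, sub_zero, ContinuousMap.coe_zero, sub_zero] at this
  · obtain ⟨g, hg⟩ := exists_continuousMap_tendsto_eLpNorm hf (repMeasure ρ ξ)
    have hlim := hg.add (h.tendsto hg).enorm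
    rw [zero_add] at hlim
    refine ge_of_tendsto' hlim fun n => ?_
    have := hf.eLpNorm_triangle (BddMeas.of_continuous (g n)) (BddMeas.const 0) (repMeasure ρ ξ)
    rw [enorm_rep]
    simpa only [← Pi.zero_def, sub_zero] using this

/-- The measures of `ξ`, `η` and `a • ξ + η` are not comparable a priori, so the approximation is
made in their sum. -/
theorem add_smul {η : K} (hf : BddMeas f) (h : IsRepLimit ρ f ξ v) (h' : IsRepLimit ρ f η w)
    (a : ℂ) : IsRepLimit ρ f (a • ξ + η) (a • v + w) := by
  obtain ⟨g, hg⟩ := exists_continuousMap_tendsto_eLpNorm hf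
    (repMeasure ρ ξ + repMeasure ρ η + repMeasure ρ (a • ξ + η))
  refine of_tendsto hf (fun n => BddMeas.of_continuous (g n))
    (fun n => isRepLimit_continuous (g n) _)
    (tendsto_eLpNorm_of_le (Measure.le_add_left le_rfl) hg) ?_
  have h1 := h.tendsto (tendsto_eLpNorm_of_le
    (Measure.le_add_right (Measure.le_add_right le_rfl)) hg)
  have h2 := h'.tendsto (tendsto_eLpNorm_of_le
    (Measure.le_add_right (Measure.le_add_left le_rfl)) hg)
  simpa using (h1.const_smul a).add h2

theorem mul_continuous (hf : BddMeas f) (h : IsRepLimit ρ f ξ v) (g : C(X, ℂ)) :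
    IsRepLimit ρ (g * f) ξ (ρ g v) := by
  obtain ⟨k, hk⟩ := exists_continuousMap_tendsto_eLpNorm hf (repMeasure ρ ξ)
  refine of_tendsto ((BddMeas.of_continuous g).mul hf)
    (fun n => BddMeas.of_continuous (g * k n)) (fun n => isRepLimit_continuous (g * k n) ξ)
    (tendsto_eLpNorm_mul (BddMeas.of_continuous g) hk) ?_
  have := ((ρ g).continuous.tendsto v).comp (h.tendsto hk)
  simpa [comp_def] using this

/-- Two stages: `g` is first continuous, then approximated in the measures of both `ξ` and `v`.
Boundedness of `f` keeps `(g - kₙ)f` small in mean square. -/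
theorem mul {g : X → ℂ} (hf : BddMeas f) (hg : BddMeas g) (h : IsRepLimit ρ f ξ v)
    (h' : IsRepLimit ρ g v w) : IsRepLimit ρ (g * f) ξ w := by
  obtain ⟨k, hk⟩ := exists_continuousMap_tendsto_eLpNorm hg (repMeasure ρ ξ + repMeasure ρ v)
  refine of_tendsto (hg.mul hf) (fun n => (BddMeas.of_continuous (k n)).mul hf)
    (fun n => h.mul_continuous hf (k n)) ?_
    (h'.tendsto (tendsto_eLpNorm_of_le (Measure.le_add_left le_rfl) hk))
  have := tendsto_eLpNorm_mul hf
    (tendsto_eLpNorm_of_le (Measure.le_add_right (ν' := repMeasure ρ v) le_rfl) hk)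
  simpa only [mul_comm] using this

/-- If `gₙ` approximates `f`, its conjugate approximates the conjugate of `f` equally well, and the
relation holds for each `gₙ`. -/
theorem inner_comm {η : K} (hf : BddMeas f) (h : IsRepLimit ρ f ξ v)
    (h' : IsRepLimit ρ (fun z => conj (f z)) η w) : inner ℂ η v = inner ℂ w ξ := by
  obtain ⟨g, hg⟩ := exists_continuousMap_tendsto_eLpNorm hf (repMeasure ρ ξ + repMeasure ρ η)
  have h1 := h.tendsto (tendsto_eLpNorm_of_le (Measure.le_add_right le_rfl) hg)
  have h2 : Tendsto (fun n => ρ (star (g n)) η) atTop (𝓝 w) := by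
    refine h'.tendsto ?_
    have := tendsto_eLpNorm_of_le (Measure.le_add_left (ν' := repMeasure ρ ξ) le_rfl) hg
    refine this.congr fun n => eLpNorm_congr_norm_ae (Eventually.of_forall fun z => ?_)
    simp only [Pi.sub_apply, ContinuousMap.star_apply, RCLike.star_def]
    rw [← map_sub, RCLike.norm_conj]
  have h3 := (tendsto_const_nhds (x := η)).inner (𝕜 := ℂ) h1
  have h4 := h2.inner (𝕜 := ℂ) (tendsto_const_nhds (x := ξ))
  refine tendsto_nhds_unique h3 (h4.congr fun n => ?_)
  rw [map_star, ContinuousLinearMap.star_eq_adjoint, ContinuousLinearMap.adjoint_inner_left]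

end IsRepLimit

theorem exists_rep_operator {f : X → ℂ} (hf : BddMeas f) :
    ∃ P : K →L[ℂ] K, ∀ ξ, IsRepLimit ρ f ξ (P ξ) := by
  choose v hv using fun ξ => IsRepLimit.exists_of_bddMeas (ρ := ρ) hf ξ
  have h0 : v 0 = 0 := by
    refine IsRepLimit.unique hf (hv 0) fun g => ?_
    simp
  have hlin : ∀ (a : ℂ) ξ η, v (a • ξ + η) = a • v ξ + v η := fun a ξ η =>
    IsRepLimit.unique hf (hv _) ((hv ξ).add_smul hf (hv η) a)
  obtain ⟨C, hC⟩ := hf.2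
  let l : K →ₗ[ℂ] K :=
    { toFun := v
      map_add' := fun ξ η => by simpa using hlin 1 ξ η
      map_smul' := fun a ξ => by simpa [h0] using hlin a ξ 0 }
  refine ⟨l.mkContinuous |C| fun ξ => ?_, hv⟩
  -- Comparison with the constant function `C`, which `ρ` sends to a scalar operator.
  have h1 : ‖v ξ‖ₑ ≤ ‖ρ (algebraMap ℂ _ (C : ℂ)) ξ‖ₑ := by
    rw [(hv ξ).enorm_eq hf, enorm_rep]
    refine eLpNorm_mono fun z => ?_
    simpa using (hC z).trans (le_abs_self C)
  rw [AlgHomClass.commutes, Algebra.algebraMap_eq_smul_one, smul_apply, one_apply_eq_self,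
    ← ofReal_norm, ← ofReal_norm, ENNReal.ofReal_le_ofReal_iff (norm_nonneg _), norm_smul] at h1
  change ‖v ξ‖ ≤ _
  simpa using h1

theorem inner_eq_measure {A : Set X} (hA : MeasurableSet A) {P : K →L[ℂ] K}
    (hP : ∀ ξ, IsRepLimit ρ (A.indicator fun _ => 1) ξ (P ξ)) (hP' : IsStarProjection P) (ξ : K) :
    inner ℂ ξ (P ξ) = ((repMeasure ρ ξ).real A : ℂ) := by
  have h1 : inner ℂ ξ (P ξ) = inner ℂ (P ξ) (P ξ) := by
    conv_lhs => rw [← hP'.isIdempotentElem.eq, mul_apply_eq_comp,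
      ← ContinuousLinearMap.adjoint_inner_left, ← ContinuousLinearMap.star_eq_adjoint,
      hP'.isSelfAdjoint.star_eq]
  have h2 := (hP ξ).enorm_eq ((BddMeas.const 1).indicator hA)
  rw [eLpNorm_indicator_const hA two_ne_zero ENNReal.ofNat_ne_top, enorm_one, one_mul] at h2
  have h3 := congrArg ENNReal.toReal h2
  rw [toReal_enorm, ← ENNReal.toReal_rpow] at h3
  have h4 : ‖P ξ‖ ^ 2 = (repMeasure ρ ξ).real A := by
    rw [h3, ← Real.rpow_natCast, ← Real.rpow_mul ENNReal.toReal_nonneg]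
    simp [Measure.real]
  rw [h1, inner_self_eq_norm_sq_to_K, ← h4]
  simp

variable (ρ) in
/-- Every representation of `C(X, ℂ)` comes from a spectral measure. -/
theorem exists_spectralMeasure :
    ∃ E : SpectralMeasure m ℂ K, E.continuousHom = ρ := by
  classical
  choose P hP using fun A : {A : Set X // MeasurableSet A} =>
    exists_rep_operator (ρ := ρ) ((BddMeas.const 1).indicator A.2)
  have hb : ∀ A : {A : Set X // MeasurableSet A}, BddMeas (A.1.indicator fun _ => (1 : ℂ)) :=
    fun A => (BddMeas.const 1).indicator A.2
  -- The indicator of an intersection is a product of indicators, so this is the product rule for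
  -- limits plus uniqueness.
  have hmul : ∀ A B : {A : Set X // MeasurableSet A}, P ⟨A ∩ B, A.2.inter B.2⟩ = P A * P B := by
    intro A B
    ext ξ
    refine IsRepLimit.unique (hb _) (hP _ ξ) ?_
    have := (hP B ξ).mul (hb B) (hb A) (hP A (P B ξ))
    have hAB : (A.1 ∩ B.1).indicator (fun _ => (1 : ℂ))
        = (A.1.indicator fun _ => 1) * B.1.indicator fun _ => 1 := by
      ext z
      by_cases hz : z ∈ A.1 <;> by_cases hz' : z ∈ B.1 <;> simp [hz, hz']
    simp only [hAB]
    exact this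
  have hproj : ∀ A, IsStarProjection (P A) := by
    intro A
    constructor
    · have := hmul A A
      simp only [inter_self] at this
      exact this.symm
    · rw [IsSelfAdjoint, ContinuousLinearMap.star_eq_adjoint, eq_comm,
        ContinuousLinearMap.eq_adjoint_iff]
      intro ξ η
      refine ((hP A η).inner_comm (hb A) ?_).symm
      convert hP A ξ using 1
      ext z
      by_cases hz : z ∈ A.1 <;> simp [hz]
  have hdiag : ∀ A ξ, inner ℂ ξ (P A ξ) = ((repMeasure ρ ξ).real A.1 : ℂ) := fun A ξ =>
    inner_eq_measure A.2 (hP A) (hproj A) ξ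
  -- On the diagonal, countable additivity is that of the positive measure `repMeasure`;
  -- polarization later extends it to all pairs of vectors.
  have hsum : ∀ (ξ : K) (A : ℕ → Set X) (hA : ∀ n, MeasurableSet (A n)), Pairwise (Disjoint on A) →
      HasSum (fun n => inner ℂ (P ⟨A n, hA n⟩ ξ) ξ)
        (inner ℂ (P ⟨⋃ n, A n, MeasurableSet.iUnion hA⟩ ξ) ξ) := by
    intro ξ A hA hd
    have h1 : ∀ A, inner ℂ (P A ξ) ξ = ((repMeasure ρ ξ).real A.1 : ℂ) := by
      intro A
      rw [← inner_conj_symm, hdiag, Complex.conj_ofReal]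
    simp only [h1]
    have := (repMeasure ρ ξ).toSignedMeasure.m_iUnion hA hd
    simp only [Measure.toSignedMeasure_apply_measurable (hA _),
      Measure.toSignedMeasure_apply_measurable (MeasurableSet.iUnion hA)] at this
    exact_mod_cast this
  let E : SpectralMeasure m ℂ K :=
    { toFun := fun A => if hA : MeasurableSet A then P ⟨A, hA⟩ else 0
      not_measurable' := fun A hA => dif_neg hA
      isStarProjection' := fun A hA => by
        rw [dif_pos hA]
        exact hproj _
      empty' := by
        rw [dif_pos MeasurableSet.empty]
        ext ξ
        refine IsRepLimit.unique (hb ⟨∅, _⟩) (hP _ ξ) ?_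
        have h := isRepLimit_continuous (ρ := ρ) 0 ξ
        rw [map_zero] at h
        convert h using 1
        ext z
        simp
      univ' := by
        rw [dif_pos MeasurableSet.univ]
        ext ξ
        refine IsRepLimit.unique (hb ⟨univ, _⟩) (hP _ ξ) ?_
        have h := isRepLimit_continuous (ρ := ρ) 1 ξ
        rw [map_one] at h
        convert h using 1
        ext z
        simp
      inter' := fun A B hA hB => by
        rw [dif_pos hA, dif_pos hB, dif_pos (hA.inter hB)]
        exact hmul ⟨A, hA⟩ ⟨B, hB⟩
      iUnion' := fun x y A hA hd => by
        simp only [dif_pos (hA _), dif_pos (MeasurableSet.iUnion hA)]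
        have hadj : ∀ A, inner ℂ y (P A x) = inner ℂ (P A y) x := fun A => by
          rw [← ContinuousLinearMap.adjoint_inner_left, ← ContinuousLinearMap.star_eq_adjoint,
            (hproj A).isSelfAdjoint.star_eq]
        have hpol : ∀ A, inner ℂ (P A y) x = (inner ℂ (P A (x + y)) (x + y)
            - inner ℂ (P A (x - y)) (x - y)
            + Complex.I * inner ℂ (P A (x + Complex.I • y)) (x + Complex.I • y)
            - Complex.I * inner ℂ (P A (x - Complex.I • y)) (x - Complex.I • y)) / 4 := fun A =>
          inner_map_polarization (P A : K →ₗ[ℂ] K) x y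
        simp only [hadj, hpol]
        exact ((((hsum _ A hA hd).sub (hsum _ A hA hd)).add ((hsum _ A hA hd).mul_left _)).sub
          ((hsum _ A hA hd).mul_left _)).div_const 4 }
  have hE : ∀ ξ, E.diag ξ = repMeasure ρ ξ := by
    intro ξ
    ext A hA
    have h1 : E A = P ⟨A, hA⟩ := dif_pos hA
    have h2 := E.inner_apply_self hA ξ
    rw [h1, hdiag] at h2
    rw [← ENNReal.toReal_eq_toReal_iff' (by finiteness) (by finiteness), ← Measure.real,
      ← Measure.real, E.diag_real hA, h1]
    exact (Complex.ofReal_injective h2).symm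
  refine ⟨E, StarAlgHom.ext fun g => ?_⟩
  -- Over `ℂ` an operator is determined by its quadratic form, and here both forms are integrals of
  -- `g` against the same measure.
  have hq : ∀ ξ, inner ℂ (E.continuousHom g ξ) ξ = inner ℂ (ρ g ξ) ξ := by
    intro ξ
    rw [← inner_conj_symm, ← inner_conj_symm (ρ g ξ), ← integral_repMeasure ρ, ← hE]
    congr 1
    exact (SpectralMeasure.inner_int (BddMeas.of_continuous g).essBdd ξ ξ).trans
      (E.form_self (BddMeas.of_continuous g) ξ)
  have := (ext_inner_map (E.continuousHom g : K →ₗ[ℂ] K) (ρ g : K →ₗ[ℂ] K)).1 hq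
  exact ContinuousLinearMap.coe_injective this

end Existence

namespace SpectralMeasure

/-- The **spectral theorem** for bounded normal operators. -/
theorem exists_isSpectralMeasureOf {K : Type*} [NormedAddCommGroup K] [InnerProductSpace ℂ K]
    [CompleteSpace K] {S : K →L[ℂ] K} (hS : IsStarNormal S) :
    ∃ E : SpectralMeasure (Subtype.instMeasurableSpace : MeasurableSpace (spectrum ℂ S)) ℂ K,
      E.IsSpectralMeasureOf S := by
  obtain ⟨E, hE⟩ := exists_spectralMeasure (cfcHom hS : C(spectrum ℂ S, ℂ) →⋆ₐ[ℂ] _)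
  refine ⟨E, fun ξ η => ?_⟩
  have h1 : E.int (fun z => (z : ℂ)) = S :=
    (DFunLike.congr_fun hE ((ContinuousMap.id ℂ).restrict (spectrum ℂ S))).trans (cfcHom_id hS)
  conv_lhs => rw [← h1]
  exact inner_int (BddMeas.of_continuous
    ((ContinuousMap.id ℂ).restrict (spectrum ℂ S))).essBdd ξ η

end SpectralMeasure

/-! ### Operators on the complexification -/

namespace Complexification

variable {H : Type*} [NormedAddCommGroup H] [InnerProductSpace ℝ H]

@[simp] theorem ofReal_re (x : H) : (ofReal x).re = x := rfl
@[simp] theorem ofReal_im (x : H) : (ofReal x).im = 0 := rfl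

theorem ofReal_add (x y : H) : ofReal (x + y) = ofReal x + ofReal y := by ext <;> simp

theorem ofReal_smul (c : ℝ) (x : H) : ofReal (c • x) = (c : ℂ) • ofReal x := by
  ext <;> simp [-Complex.coe_smul]

theorem norm_ofReal (x : H) : ‖ofReal x‖ = ‖x‖ := by
  have := norm_sq (ofReal x)
  simpa using this

theorem eq_ofReal_add (a : Complexification H) :
    a = ofReal a.re + Complex.I • ofReal a.im := by
  ext <;> simp

theorem inner_ofReal_left (y : H) (a : Complexification H) :
    (inner ℂ (ofReal y) a).re = inner ℝ y a.re := by
  simp [inner_def, real_inner_comm]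

theorem inner_ofReal (x y : H) : inner ℂ (ofReal y) (ofReal x) = ((inner ℝ x y : ℝ) : ℂ) := by
  rw [inner_def]
  apply Complex.ext <;> simp

theorem inner_conjC (a b : Complexification H) :
    inner ℂ (conjC a) (conjC b) = conj (inner ℂ a b) := by
  rw [inner_def, inner_def]
  apply Complex.ext
  · simp
  · simp; ring

theorem inner_conjC_left (a b : Complexification H) :
    inner ℂ (conjC a) b = conj (inner ℂ a (conjC b)) := by
  rw [← inner_conjC, conjC_conjC]

theorem conjC_ofReal (x : H) : conjC (ofReal x) = ofReal x := by ext <;> simp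

theorem inner_flat (S : Complexification H →L[ℂ] Complexification H)
    (a b : Complexification H) :
    inner ℂ b (flat S a) = conj (inner ℂ (conjC b) (S (conjC a))) := by
  rw [inner_conjC_left, Complex.conj_conj, flat_apply]

theorem flat_complexExt (T : H →L[ℝ] H) : flat (complexExt T) = complexExt T := by
  ext a <;> simp

theorem complexExt_mul (T R : H →L[ℝ] H) : complexExt (T * R) = complexExt T * complexExt R := by
  ext a <;> simp

theorem complexExt_ofReal (T : H →L[ℝ] H) (x : H) : complexExt T (ofReal x) = ofReal (T x) := by
  ext <;> simp

/-- The operator `x ↦ Re (S x)` on the real space. -/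
def reOp (S : Complexification H →L[ℂ] Complexification H) : H →L[ℝ] H :=
  LinearMap.mkContinuous
    { toFun := fun x => (S (ofReal x)).re
      map_add' := fun x y => by rw [ofReal_add, map_add, add_re]
      map_smul' := fun c x => by rw [ofReal_smul, map_smul]; simp [-Complex.coe_smul] } ‖S‖ (fun x =>
        (norm_re_le _).trans ((S.le_opNorm _).trans (by rw [norm_ofReal])))

theorem reOp_apply (S : Complexification H →L[ℂ] Complexification H) (x : H) :
    reOp S x = (S (ofReal x)).re := rfl

variable (S R : Complexification H →L[ℂ] Complexification H) (T : H →L[ℝ] H)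

theorem reOp_add : reOp (S + R) = reOp S + reOp R := by
  ext x; simp [reOp_apply]

theorem reOp_zero : reOp (0 : Complexification H →L[ℂ] Complexification H) = 0 := by
  ext x; simp [reOp_apply]

theorem reOp_smul_one (c : ℝ) :
    reOp ((c : ℂ) • (1 : Complexification H →L[ℂ] Complexification H)) = c • 1 := by
  ext x; simp [reOp_apply, -Complex.coe_smul]

theorem reOp_complexExt : reOp (complexExt T) = T := by
  ext x; simp [reOp_apply]

theorem reOp_mul_complexExt : reOp (S * complexExt T) = reOp S * T := by
  ext x
  simp [reOp_apply, complexExt_ofReal]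

theorem reOp_complexExt_mul : reOp (complexExt T * S) = T * reOp S := by
  ext x; simp [reOp_apply]

variable {S R}

/-- An operator commuting with the conjugation `C` preserves its fixed vectors, which form the real
space. -/
theorem ofReal_reOp (h : flat S = S) (x : H) : ofReal (reOp S x) = S (ofReal x) := by
  have h1 : (S (ofReal x)).im = 0 := by
    have h2 : (flat S (ofReal x)).im = (S (ofReal x)).im := by rw [h]
    rw [flat_apply, conjC_ofReal, conjC_im] at h2
    have h3 : (2 : ℝ) • (S (ofReal x)).im = 0 := by
      rw [two_smul]
      nth_rewrite 1 [← h2]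
      exact neg_add_cancel _
    simpa using h3
  ext
  · rfl
  · exact h1.symm

theorem complexExt_reOp (h : flat S = S) : complexExt (reOp S) = S := by
  ext a : 1
  conv_rhs => rw [eq_ofReal_add a, map_add, map_smul, ← ofReal_reOp h, ← ofReal_reOp h]
  ext <;> simp

/-- Only the inner factor must preserve the real space. -/
theorem reOp_mul (hR : flat R = R) : reOp (S * R) = reOp S * reOp R := by
  rw [← reOp_mul_complexExt, complexExt_reOp hR]

/-- The squared norm splits as a sum over real and imaginary parts, so no factor is lost. -/
theorem norm_complexExt : ‖complexExt T‖ = ‖T‖ := by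
  apply le_antisymm
  · refine ContinuousLinearMap.opNorm_le_bound _ (norm_nonneg _) fun a => ?_
    refine abs_le_of_sq_le_sq' ?_ (by positivity) |>.2
    rw [mul_pow, norm_sq, norm_sq a, mul_add, ← mul_pow, ← mul_pow, complexExt_re, complexExt_im]
    gcongr <;> exact T.le_opNorm _
  · refine ContinuousLinearMap.opNorm_le_bound T (norm_nonneg (complexExt T)) fun x => ?_
    rw [← norm_ofReal, ← norm_ofReal x, ← complexExt_ofReal]
    exact (complexExt T).le_opNorm _

variable [CompleteSpace H]

theorem adjoint_flat : ContinuousLinearMap.adjoint (flat S) = flat (ContinuousLinearMap.adjoint S) := by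
  rw [eq_comm, ContinuousLinearMap.eq_adjoint_iff]
  intro a b
  rw [inner_flat, flat_apply, inner_conjC_left, ContinuousLinearMap.adjoint_inner_left]

theorem adjoint_complexExt :
    ContinuousLinearMap.adjoint (complexExt T) = complexExt (ContinuousLinearMap.adjoint T) := by
  rw [eq_comm, ContinuousLinearMap.eq_adjoint_iff]
  intro a b
  simp only [inner_def, complexExt_re, complexExt_im, ContinuousLinearMap.adjoint_inner_right]

theorem isStarNormal_complexExt (hT : IsStarNormal T) : IsStarNormal (complexExt T) := by
  constructor
  rw [ContinuousLinearMap.star_eq_adjoint, adjoint_complexExt, Commute, SemiconjBy,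
    ← complexExt_mul, ← complexExt_mul, ← ContinuousLinearMap.star_eq_adjoint,
    hT.star_comm_self.eq]

theorem reOp_adjoint :
    reOp (ContinuousLinearMap.adjoint S) = ContinuousLinearMap.adjoint (reOp S) := by
  rw [ContinuousLinearMap.eq_adjoint_iff]
  intro x y
  rw [real_inner_comm, reOp_apply, reOp_apply, ← inner_ofReal_left, ← inner_ofReal_left,
    ContinuousLinearMap.adjoint_inner_right, ← inner_conj_symm, Complex.conj_re]

end Complexification

theorem measurableSet_ne_fun {X : Type*} {m : MeasurableSpace X} {f g : X → ℂ}
    (hf : Measurable f) (hg : Measurable g) : MeasurableSet {z | f z = g z}ᶜ :=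
  (measurableSet_eq_fun hf hg).compl

/-! ### Conjugation symmetry of the spectral measure and its restriction to the real space -/

section Symmetry

open Complexification

variable {H : Type*} [NormedAddCommGroup H] [InnerProductSpace ℝ H] [CompleteSpace H]
  {T : H →L[ℝ] H}
  (E : SpectralMeasure (Subtype.instMeasurableSpace : MeasurableSpace (spectrum ℂ (complexExt T))) ℂ
    (Complexification H))

theorem specConj_involutive : Involutive (specConj T) := fun z => by
  apply Subtype.ext
  exact Complex.conj_conj _

theorem measurableSet_preimage_specConj {A : Set (spectrum ℂ (complexExt T))} :
    MeasurableSet (specConj T ⁻¹' A) ↔ MeasurableSet A := by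
  refine ⟨fun h => ?_, fun h => measurable_specConj T h⟩
  have := measurable_specConj T h
  rwa [← preimage_comp, specConj_involutive.comp_self, preimage_id] at this

/-- The spectral measure `A ↦ E(A')♭`, where `A'` is the complex-conjugate set of `A`. -/
def SpectralMeasure.conjugate : SpectralMeasure
    (Subtype.instMeasurableSpace : MeasurableSpace (spectrum ℂ (complexExt T))) ℂ
    (Complexification H) where
  toFun A := flat (E (specConj T ⁻¹' A))
  not_measurable' A hA := by
    rw [E.not_measurable' _ (measurableSet_preimage_specConj.not.2 hA)]
    ext a <;> simp
  isStarProjection' A hA := by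
    have h := E.isStarProjection' _ (measurableSet_preimage_specConj.2 hA)
    constructor
    · rw [IsIdempotentElem, ← flat_mul, h.isIdempotentElem.eq]
    · rw [IsSelfAdjoint, ContinuousLinearMap.star_eq_adjoint, adjoint_flat,
        ← ContinuousLinearMap.star_eq_adjoint, h.isSelfAdjoint.star_eq]
  empty' := by
    rw [preimage_empty, E.empty']
    ext a <;> simp
  univ' := by
    rw [preimage_univ, E.univ']
    ext a <;> simp
  inter' A B hA hB := by
    rw [preimage_inter, E.inter' _ _ (measurableSet_preimage_specConj.2 hA)
      (measurableSet_preimage_specConj.2 hB), flat_mul]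
  iUnion' x y A hA hd := by
    simp only [inner_flat, preimage_iUnion]
    exact Complex.hasSum_conj'.2 (E.iUnion' _ _ _
      (fun n => measurableSet_preimage_specConj.2 (hA n))
      fun i j hij => (hd hij).preimage _)

/-- Change of variables under `z ↦ z̄`, checked on indicators; the outer conjugations come from the
antilinearity of `C`. -/
theorem SpectralMeasure.form_conjugate {f : spectrum ℂ (complexExt T) → ℂ} (hf : BddMeas f)
    (ξ η : Complexification H) : E.conjugate.form (fun z => conj (f (specConj T z))) ξ η
      = conj (E.form f (conjC ξ) (conjC η)) := by
  have h := ((E.conjugate.isBddIntegral_form ξ η).conj_comp.comp (measurable_specConj T)).ext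
    (E.isBddIntegral_form (conjC ξ) (conjC η)) (fun A c hA => ?_) hf
  · rw [← h, Complex.conj_conj]
    rfl
  · have h2 : (fun z => conj ((A.indicator (fun _ => c) ∘ specConj T) z))
        = (specConj T ⁻¹' A).indicator fun _ => conj c := by
      ext z
      by_cases hz : specConj T z ∈ A <;> simp [hz]
    simp only [h2, E.conjugate.form_indicator (measurable_specConj T hA), E.form_indicator hA]
    change conj (conj c * inner ℂ η (flat (E (specConj T ⁻¹' (specConj T ⁻¹' A))) ξ)) = _
    rw [inner_flat, ← preimage_comp, specConj_involutive.comp_self, preimage_id, map_mul,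
      Complex.conj_conj, Complex.conj_conj]

variable {E}

/-- The conjugate measure also represents `T_ℂ`, since `T_ℂ♭ = T_ℂ` and the identity function is a
stem function. Uniqueness does the rest; all symmetry of `E` flows from here. -/
theorem SpectralMeasure.IsSpectralMeasureOf.conjugate_eq (hT : IsStarNormal T)
    (hE : E.IsSpectralMeasureOf (complexExt T)) : E.conjugate = E := by
  refine IsSpectralMeasureOf.unique (isStarNormal_complexExt T hT) (fun ξ η => ?_) hE
  have h := E.form_conjugate (BddMeas.of_continuous
    ((ContinuousMap.id ℂ).restrict (spectrum ℂ (complexExt T)))) ξ η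
  have h1 := hE (conjC ξ) (conjC η)
  have h2 : E.form (fun z : spectrum ℂ (complexExt T) => (z : ℂ)) (conjC ξ) (conjC η)
      = inner ℂ (conjC η) (complexExt T (conjC ξ)) := h1.symm
  have h3 : (fun z : spectrum ℂ (complexExt T) => conj (((ContinuousMap.id ℂ).restrict
      (spectrum ℂ (complexExt T))) (specConj T z)))
      = fun z : spectrum ℂ (complexExt T) => (z : ℂ) := by
    ext z
    exact Complex.conj_conj _
  rw [h3] at h
  refine Eq.trans ?_ h.symm
  change _ = conj (E.form (fun z : spectrum ℂ (complexExt T) => (z : ℂ)) (conjC ξ) (conjC η))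
  rw [h2, ← inner_flat, flat_complexExt]

theorem flat_apply_eq (hE : E.conjugate = E) (A : Set (spectrum ℂ (complexExt T))) :
    flat (E A) = E (specConj T ⁻¹' A) := by
  conv_rhs => rw [← hE]
  change _ = flat (E (specConj T ⁻¹' (specConj T ⁻¹' A)))
  rw [← preimage_comp, specConj_involutive.comp_self, preimage_id]

/-- Conjugation preserves null sets, because the projection of a conjugate set is the `♭` of the
original one. -/
theorem ae_comp_specConj (hE : E.conjugate = E) {f g : spectrum ℂ (complexExt T) → ℂ}
    (hf : Measurable f) (hg : Measurable g) (h : ∀ ξ, f =ᵐ[E.diag ξ] g) (ξ : Complexification H) :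
    f ∘ specConj T =ᵐ[E.diag ξ] g ∘ specConj T := by
  have hA : MeasurableSet {z | f z = g z}ᶜ := (measurableSet_eq_fun hf hg).compl
  have h0 : E {z | f z = g z}ᶜ = 0 := (E.eq_zero_iff hA).2 h
  have h1 : E (specConj T ⁻¹' {z | f z = g z}ᶜ) = 0 := by
    rw [← flat_apply_eq hE, h0]
    ext a <;> simp
  exact (E.eq_zero_iff (measurable_specConj T hA)).1 h1 ξ

theorem flat_int (hE : E.conjugate = E) {f : spectrum ℂ (complexExt T) → ℂ} (hf : E.EssBdd f)
    (hs : ∀ ξ, ∀ᵐ z ∂E.diag ξ, f (specConj T z) = conj (f z)) : flat (E.int f) = E.int f := by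
  obtain ⟨g, hg, hfg⟩ := hf.exists_bddMeas
  -- The bounded representative `g` need not be a stem function, but its reflected conjugate still
  -- equals `f` almost everywhere.
  have h1 : E.int f = E.int (fun z => conj (g (specConj T z))) := by
    refine E.int_congr fun ξ => ?_
    filter_upwards [hs ξ, ae_comp_specConj hE hf.1 hg.1 hfg ξ] with z hz hz'
    simp only [comp_apply] at hz'
    rw [← hz', hz, Complex.conj_conj]
  have h2 := (hg.comp (measurable_specConj T)).conj_comp
  conv_rhs => rw [h1]
  rw [E.int_congr hfg]
  symm
  refine SpectralMeasure.int_eq_of_inner h2.essBdd fun ξ η => ?_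
  rw [inner_flat, SpectralMeasure.inner_int hg.essBdd, ← E.form_conjugate hg, hE]
  rfl

variable (E) in
/-- The σ-algebra of the Borel sets which agree with their complex-conjugates up to null sets. -/
@[reducible]
def symmSigma : MeasurableSpace (spectrum ℂ (complexExt T)) where
  MeasurableSet' A := MeasurableSet A ∧ ∀ ξ, A =ᵐ[E.diag ξ] specConj T ⁻¹' A
  measurableSet_empty := ⟨MeasurableSet.empty, fun _ => EventuallyEq.rfl⟩
  measurableSet_compl A hA := ⟨hA.1.compl, fun ξ => by
    rw [preimage_compl]
    exact (hA.2 ξ).compl⟩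
  measurableSet_iUnion A hA := ⟨MeasurableSet.iUnion fun n => (hA n).1, fun ξ => by
    rw [preimage_iUnion]
    exact Filter.EventuallyEq.countable_iUnion fun n => (hA n).2 ξ⟩

theorem symmSigma_le : symmSigma E ≤ Subtype.instMeasurableSpace := fun _ hA => hA.1

/-- The almost everywhere description makes the σ-algebra axioms immediate; this recovers the
description by projections. -/
theorem measurableSet_symmSigma_iff {A : Set (spectrum ℂ (complexExt T))} :
    MeasurableSet[symmSigma E] A ↔ MeasurableSet A ∧ E A = E (specConj T ⁻¹' A) := by
  constructor
  · exact fun h => ⟨h.1, (E.eq_iff h.1 (measurable_specConj T h.1)).2 h.2⟩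
  · exact fun h => ⟨h.1, (E.eq_iff h.1 (measurable_specConj T h.1)).1 h.2⟩

theorem flat_of_measurableSet (hE : E.conjugate = E) {A : Set (spectrum ℂ (complexExt T))}
    (hA : MeasurableSet[symmSigma E] A) : flat (E A) = E A := by
  rw [flat_apply_eq hE, ← (measurableSet_symmSigma_iff.1 hA).2]

open Classical in
/-- The restriction of `E` to the real space. -/
def realSpectralMeasure (hE : E.conjugate = E) : SpectralMeasure (symmSigma E) ℝ H where
  toFun A := if MeasurableSet[symmSigma E] A then reOp (E A) else 0
  not_measurable' _ hA := if_neg hA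
  isStarProjection' A hA := by
    rw [if_pos hA]
    have h := E.isStarProjection' A hA.1
    constructor
    · rw [IsIdempotentElem, ← reOp_mul (flat_of_measurableSet hE hA), h.isIdempotentElem.eq]
    · rw [IsSelfAdjoint, ContinuousLinearMap.star_eq_adjoint, ← reOp_adjoint,
        ← ContinuousLinearMap.star_eq_adjoint, h.isSelfAdjoint.star_eq]
  empty' := by
    rw [if_pos (@MeasurableSet.empty _ (symmSigma E)), E.empty', reOp_zero]
  univ' := by
    rw [if_pos (@MeasurableSet.univ _ (symmSigma E)), E.univ']
    simpa using reOp_smul_one (H := H) 1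
  inter' A B hA hB := by
    rw [if_pos hA, if_pos hB, if_pos (hA.inter hB), E.inter' A B hA.1 hB.1,
      reOp_mul (flat_of_measurableSet hE hB)]
  iUnion' x y A hA hd := by
    simp only [if_pos (hA _), if_pos (MeasurableSet.iUnion hA), reOp_apply,
      ← inner_ofReal_left]
    exact Complex.hasSum_re (E.iUnion' (ofReal x) (ofReal y) A (fun n => (hA n).1) hd)

variable {A : Set (spectrum ℂ (complexExt T))} (hE : E.conjugate = E)

theorem realSpectralMeasure_eq (hA : MeasurableSet[symmSigma E] A) :
    realSpectralMeasure hE A = reOp (E A) := if_pos hA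

theorem complexExt_realSpectralMeasure (hA : MeasurableSet[symmSigma E] A) :
    complexExt (realSpectralMeasure hE A) = E A := by
  rw [realSpectralMeasure_eq hE hA, complexExt_reOp (flat_of_measurableSet hE hA)]

theorem ofReal_realSpectralMeasure (hA : MeasurableSet[symmSigma E] A) (x : H) :
    ofReal (realSpectralMeasure hE A x) = E A (ofReal x) := by
  rw [realSpectralMeasure_eq hE hA, ofReal_reOp (flat_of_measurableSet hE hA)]

theorem assoc_ofReal (hA : MeasurableSet[symmSigma E] A) (x y : H) :
    E.assoc (ofReal x) (ofReal y) A = ((inner ℝ (realSpectralMeasure hE A x) y : ℝ) : ℂ) := by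
  rw [SpectralMeasure.assoc_apply, ← ofReal_realSpectralMeasure hE hA, inner_ofReal]

/-- The embedding of the real space is isometric and intertwines the projections; trimming is needed
since only the smaller σ-algebra is available. -/
theorem diag_realSpectralMeasure (x : H) :
    (realSpectralMeasure hE).diag x = (E.diag (ofReal x)).trim symmSigma_le := by
  refine @Measure.ext _ (symmSigma E) _ _ fun A hA => ?_
  rw [trim_measurableSet_eq _ hA, SpectralMeasure.diag_apply _ hA, E.diag_apply hA.1,
    ← ofReal_realSpectralMeasure hE hA, norm_ofReal]

theorem ae_diag_of_realSpectralMeasure (hA : MeasurableSet[symmSigma E] A)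
    (h : ∀ x, (realSpectralMeasure hE).diag x A = 0) (ξ : Complexification H) :
    E.diag ξ A = 0 := by
  refine (E.eq_zero_iff hA.1).1 ?_ ξ
  rw [← complexExt_realSpectralMeasure hE hA, (SpectralMeasure.eq_zero_iff _ hA).2 h]
  ext a <;> simp

/-- For functions measurable on the small σ-algebra, integrals against `E` reduce to integrals
against its restriction to the real space. -/
theorem form_ofReal {f : spectrum ℂ (complexExt T) → ℂ} (hf : E.EssBdd f)
    (hm : Measurable[symmSigma E] f) (x y : H) :
    ((realSpectralMeasure hE).assoc x y).Integrable f ∧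
      E.form f (ofReal x) (ofReal y) = ∫ᵛ z, f z ∂<•((realSpectralMeasure hE).assoc x y) := by
  have hb : (realSpectralMeasure hE).EssBdd f := by
    obtain ⟨-, r, hr, h0⟩ := hf
    have hA : MeasurableSet[symmSigma E] {z | r ≤ ‖f z‖} :=
      measurable_norm.comp hm measurableSet_Ici
    refine ⟨hm, r, hr, ?_⟩
    rw [realSpectralMeasure_eq hE hA, h0, reOp_zero]
  refine ⟨hb.integrable_variation x y, ?_⟩
  -- The cut-off is made for the real measure so that `g` stays measurable on the small σ-algebra.
  obtain ⟨g, hg, hfg⟩ := hb.exists_bddMeas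
  have hA : MeasurableSet[symmSigma E] {z | f z = g z}ᶜ :=
    measurableSet_ne_fun hm (@BddMeas.measurable _ (symmSigma E) _ hg)
  have hfg' : ∀ ξ, f =ᵐ[E.diag ξ] g := ae_diag_of_realSpectralMeasure hE hA hfg
  rw [E.form_congr hfg', VectorMeasure.integral_congr_ae
    (SpectralMeasure.ae_variation _ hfg x y)]
  -- The identity, as a map from the Borel σ-algebra to the smaller one, restricts the test to
  -- indicators of symmetric sets.
  refine ((E.isBddIntegral_form (ofReal x) (ofReal y)).comp
    (measurable_id'' symmSigma_le)).ext (isBddIntegral_vectorMeasure _ _) (fun A c hA => ?_) hg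
  rw [comp_id, E.form_indicator hA.1, integral_indicator_const_vectorMeasure _ _ hA,
    ← SpectralMeasure.assoc_apply, assoc_ofReal hE hA, SpectralMeasure.assoc_apply,
    real_inner_comm]
  simp [mul_comm]

theorem SpectralMeasure.assoc_self_eq {X K : Type*} {m : MeasurableSpace X} [NormedAddCommGroup K]
    [InnerProductSpace ℝ K] [CompleteSpace K] (F : SpectralMeasure m ℝ K) (x : K) :
    F.assoc x x = (F.diag x).toSignedMeasure := by
  ext A hA
  rw [Measure.toSignedMeasure_apply_measurable hA, F.diag_real hA, assoc_apply,
    F.inner_apply_self hA]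
  rfl

theorem norm_int_sq_ofReal {f : spectrum ℂ (complexExt T) → ℂ} (hf : E.EssBdd f)
    (hm : Measurable[symmSigma E] fun z => ‖f z‖ ^ 2) (x : H) :
    ((realSpectralMeasure hE).assoc x x).Integrable (fun z => ‖f z‖ ^ 2) ∧
      ‖E.int f (ofReal x)‖ ^ 2 = ∫ᵛ z, ‖f z‖ ^ 2 ∂•((realSpectralMeasure hE).assoc x x) := by
  have h1 : Integrable (fun z => ‖f z‖ ^ 2) (E.diag (ofReal x)) := by
    obtain ⟨s, hs, hs'⟩ := hf.2
    refine Integrable.of_bound (hf.1.norm.pow_const 2).aestronglyMeasurable (s ^ 2) ?_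
    filter_upwards [SpectralMeasure.EssBdd.ae_lt hf.1 hs' (ofReal x)] with z hz
    rw [norm_pow, norm_norm]
    gcongr
  have hsm := hm.stronglyMeasurable
  rw [SpectralMeasure.assoc_self_eq]
  constructor
  · rw [VectorMeasure.Integrable, Measure.variation_toSignedMeasure, diag_realSpectralMeasure]
    exact h1.trim symmSigma_le hsm
  · have hB : (ContinuousLinearMap.lsmul ℝ ℝ : ℝ →L[ℝ] ℝ →L[ℝ] ℝ)
        = (ContinuousLinearMap.lsmul ℝ ℝ).flip := by
      ext
      simp
    rw [hB, VectorMeasure.integral_toSignedMeasure, diag_realSpectralMeasure,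
      ← integral_trim symmSigma_le hsm, SpectralMeasure.norm_int_sq hf]

end Symmetry

/-! ### The functional calculus on the real space and the restricted spectrum -/

section Calculus

open Complexification

variable {H : Type*} [NormedAddCommGroup H] [InnerProductSpace ℝ H] [CompleteSpace H]
  {T : H →L[ℝ] H}
  {E : SpectralMeasure (Subtype.instMeasurableSpace : MeasurableSpace (spectrum ℂ (complexExt T))) ℂ
    (Complexification H)} (hE : E.conjugate = E)

theorem essBdd_of_stem (f : stemFunctions E) : E.EssBdd f.1 := ⟨f.2.1, f.2.2.1⟩

theorem ae_of_stem (f : stemFunctions E) (ξ : Complexification H) :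
    ∀ᵐ z ∂E.diag ξ, f.1 (specConj T z) = conj (f.1 z) :=
  (E.eq_zero_iff (measurableSet_ne_fun (f.2.1.comp (measurable_specConj T))
    (Complex.continuous_conj.measurable.comp f.2.1))).1 f.2.2.2 ξ

theorem flat_int_stem (hE : E.conjugate = E) (f : stemFunctions E) : flat (E.int f.1) = E.int f.1 :=
  flat_int hE (essBdd_of_stem f) (ae_of_stem f)

theorem conj_mem_stemFunctions (f : stemFunctions E) :
    (fun z => (starRingEnd ℂ) (f.1 z)) ∈ stemFunctions E := by
  refine ⟨Complex.continuous_conj.measurable.comp f.2.1, ?_, ?_⟩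
  · obtain ⟨r, hr, h⟩ := f.2.2.1
    exact ⟨r, hr, by simpa using h⟩
  · have h := f.2.2.2
    convert h using 3
    ext z
    simp only [ne_eq]
    rw [(RingHom.injective (starRingEnd ℂ)).eq_iff]

/-- The functional calculus for essentially bounded stem functions. -/
def stemCalculus : stemFunctions E →ₐ[ℝ] (H →L[ℝ] H) where
  toFun f := reOp (E.int f.1)
  map_one' := by
    have := SpectralMeasure.int_const (E := E) ((1 : ℝ) : ℂ)
    have h1 : E.int (1 : stemFunctions E).1 = ((1 : ℝ) : ℂ) • 1 := by
      rw [← this]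
      congr 1
    rw [h1, reOp_smul_one, one_smul]
  map_mul' f g := by
    rw [← reOp_mul (flat_int_stem hE g), ← SpectralMeasure.int_mul (essBdd_of_stem f)
      (essBdd_of_stem g)]
    rfl
  map_zero' := by
    have := SpectralMeasure.int_const (E := E) ((0 : ℝ) : ℂ)
    have h1 : E.int (0 : stemFunctions E).1 = ((0 : ℝ) : ℂ) • 1 := by
      rw [← this]
      congr 1
    rw [h1, reOp_smul_one, zero_smul]
  map_add' f g := by
    rw [← reOp_add, ← SpectralMeasure.int_add (essBdd_of_stem f) (essBdd_of_stem g)]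
    rfl
  commutes' r := by
    rw [Algebra.algebraMap_eq_smul_one (A := H →L[ℝ] H), ← reOp_smul_one,
      ← SpectralMeasure.int_const]
    rfl

theorem stemCalculus_eq_zero (f : stemFunctions E) (hf : f ∈ nullFunctions E) :
    stemCalculus hE f = 0 := by
  have h0 : ∀ ξ, f.1 =ᵐ[E.diag ξ] fun _ => ((0 : ℝ) : ℂ) := fun ξ => by
    have := (E.eq_zero_iff (measurableSet_ne_fun f.2.1 measurable_const)).1 hf ξ
    rw [Complex.ofReal_zero]
    exact this
  change reOp (E.int f.1) = 0
  rw [E.int_congr h0, SpectralMeasure.int_const, reOp_smul_one, zero_smul]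

/-- The functional calculus on classes of essentially bounded stem functions. -/
def linfCalculus : LinfStem E →ₐ[ℝ] (H →L[ℝ] H) :=
  Ideal.Quotient.liftₐ (nullFunctions E) (stemCalculus hE) (stemCalculus_eq_zero hE)

theorem linfCalculus_mk (f : stemFunctions E) :
    linfCalculus hE (LinfStem.mk E f) = reOp (E.int f.1) := rfl

theorem complexExt_linfCalculus (f : stemFunctions E) :
    complexExt (linfCalculus hE (LinfStem.mk E f)) = E.int f.1 := by
  rw [linfCalculus_mk, complexExt_reOp (flat_int_stem hE f)]

theorem inner_linfCalculus (f : stemFunctions E) (x y : H) :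
    ((inner ℝ (linfCalculus hE (LinfStem.mk E f) x) y : ℝ) : ℂ)
      = E.form f.1 (ofReal x) (ofReal y) := by
  rw [← inner_ofReal, ← complexExt_ofReal, complexExt_linfCalculus,
    SpectralMeasure.inner_int (essBdd_of_stem f)]

theorem linfCalculus_conj (f : stemFunctions E) :
    linfCalculus hE (LinfStem.mk E ⟨_, conj_mem_stemFunctions f⟩)
      = ContinuousLinearMap.adjoint (linfCalculus hE (LinfStem.mk E f)) := by
  rw [linfCalculus_mk, linfCalculus_mk, ← reOp_adjoint,
    SpectralMeasure.int_conj (essBdd_of_stem f)]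

/-- `f` and its conjugate commute in the commutative algebra of stem functions. -/
theorem isStarNormal_linfCalculus (f : stemFunctions E) :
    IsStarNormal (linfCalculus hE (LinfStem.mk E f)) := by
  constructor
  rw [ContinuousLinearMap.star_eq_adjoint, ← linfCalculus_conj hE]
  exact (Commute.all (⟨_, conj_mem_stemFunctions f⟩ : stemFunctions E) f).map (stemCalculus hE)

theorem id_mem_stemFunctions (E : SpectralMeasure
    (Subtype.instMeasurableSpace : MeasurableSpace (spectrum ℂ (complexExt T))) ℂ
    (Complexification H)) :
    (fun z : spectrum ℂ (complexExt T) => (z : ℂ)) ∈ stemFunctions E := by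
  have h : E.EssBdd (fun z : spectrum ℂ (complexExt T) => (z : ℂ)) := (BddMeas.of_continuous
    ((ContinuousMap.id ℂ).restrict (spectrum ℂ (complexExt T)))).essBdd
  refine ⟨h.1, h.2, ?_⟩
  convert E.empty'
  ext z
  simp [specConj]

/-- Algebra morphisms commute with polynomial evaluation, so only the identity function has to be
identified with `T`. -/
theorem linfCalculus_polynomial (hES : E.IsSpectralMeasureOf (complexExt T)) (p : ℝ[X]) :
    ∃ hp : (fun z : spectrum ℂ (complexExt T) => Polynomial.aeval (z : ℂ) p) ∈ stemFunctions E,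
      linfCalculus hE (LinfStem.mk E ⟨_, hp⟩) = Polynomial.aeval T p := by
  set i : stemFunctions E := ⟨_, id_mem_stemFunctions E⟩
  have h : (fun z : spectrum ℂ (complexExt T) => Polynomial.aeval (z : ℂ) p)
      = (Polynomial.aeval i p).1 := by
    rw [Polynomial.aeval_subalgebra_coe]
    ext z
    exact Polynomial.aeval_algHom_apply
      (Pi.evalAlgHom ℝ (fun _ : spectrum ℂ (complexExt T) => ℂ) z) i.1 p
  have hi : stemCalculus hE i = T := by
    change reOp (E.int fun z => (z : ℂ)) = T
    rw [hES.int_id, reOp_complexExt]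
  have hp : (fun z : spectrum ℂ (complexExt T) => Polynomial.aeval (z : ℂ) p) ∈ stemFunctions E := by
    rw [h]
    exact (Polynomial.aeval i p).2
  refine ⟨hp, ?_⟩
  have h2 : (⟨_, hp⟩ : stemFunctions E) = Polynomial.aeval i p := Subtype.ext h
  have h3 := Polynomial.aeval_algHom_apply (stemCalculus hE) i p
  rw [h2]
  exact h3.symm.trans (congrArg (fun R => Polynomial.aeval R p) hi)

/-- `|f|` is conjugation invariant almost everywhere, hence so are its level sets. -/
theorem measurable_norm_sq_stem (f : stemFunctions E) :
    Measurable[symmSigma E] fun z => ‖f.1 z‖ ^ 2 := by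
  intro B hB
  refine ⟨(f.2.1.norm.pow_const 2) hB, fun ξ => ?_⟩
  filter_upwards [ae_of_stem f ξ] with z hz
  change (‖f.1 z‖ ^ 2 ∈ B) = (‖f.1 (specConj T z)‖ ^ 2 ∈ B)
  rw [hz, RCLike.norm_conj]

theorem commute_realSpectralMeasure (hT : IsStarNormal T)
    (hES : E.IsSpectralMeasureOf (complexExt T)) {S : H →L[ℝ] H} (hS : Commute S T)
    {A : Set (spectrum ℂ (complexExt T))} (hA : MeasurableSet[symmSigma E] A) :
    Commute S (realSpectralMeasure hE A) := by
  have h1 : Commute (complexExt S) (complexExt T) := by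
    rw [Commute, SemiconjBy, ← complexExt_mul, ← complexExt_mul, hS.eq]
  have h2 := hES.commute (isStarNormal_complexExt T hT) h1 hA.1
  rw [realSpectralMeasure_eq hE hA, Commute, SemiconjBy, ← reOp_complexExt_mul, h2.eq,
    reOp_mul_complexExt]

/-- Off the closure of `A`, the operator `(u - T)² + v²` is invertible modulo the complement of the
spectral subspace of `A`. -/
theorem exists_inverse_modulo (hES : E.IsSpectralMeasureOf (complexExt T))
    {A : Set (spectrum ℂ (complexExt T))} (hA : MeasurableSet[symmSigma E] A) {w : ℂ}
    (hw : w ∉ closure (Subtype.val '' A)) :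
    ∃ G : H →L[ℝ] H,
      G * ((w.re • (1 : H →L[ℝ] H) - T) ^ 2 + (w.im ^ 2) • (1 : H →L[ℝ] H))
        = realSpectralMeasure hE A ∧
      ((w.re • (1 : H →L[ℝ] H) - T) ^ 2 + (w.im ^ 2) • (1 : H →L[ℝ] H)) * G
        = realSpectralMeasure hE A ∧
      realSpectralMeasure hE A * G = G := by
  set F : H →L[ℝ] H := (w.re • (1 : H →L[ℝ] H) - T) ^ 2 + (w.im ^ 2) • (1 : H →L[ℝ] H) with hF
  obtain ⟨r, hr, hrA⟩ : ∃ r > 0, ∀ z ∈ A, r ≤ ‖(z : ℂ) - w‖ := by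
    rw [Metric.mem_closure_iff] at hw
    push Not at hw
    obtain ⟨r, hr, h⟩ := hw
    exact ⟨r, hr, fun z hz => by simpa [dist_eq_norm, norm_sub_rev] using h z ⟨z, hz, rfl⟩⟩
  -- `A` may have points near `w̄`; its symmetric part has the same projection and keeps distance at
  -- least `r` from both `w` and `w̄`.
  set A' := A ∩ specConj T ⁻¹' A
  have hA' : MeasurableSet A' := hA.1.inter (measurable_specConj T hA.1)
  have hEA' : E A' = E A := by
    refine (E.eq_iff hA' hA.1).2 fun ξ => ?_
    simpa using (EventuallyEq.refl _ A).inter (hA.2 ξ).symm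
  set p : spectrum ℂ (complexExt T) → ℂ :=
    fun z => ((w.re : ℂ) - z) * ((w.re : ℂ) - z) + ((w.im ^ 2 : ℝ) : ℂ) with hp
  have hpw : ∀ z, p z = ((z : ℂ) - w) * ((z : ℂ) - conj w) := by
    intro z
    simp only [hp]
    apply Complex.ext <;> simp [-Complex.ofReal_pow] <;> ring
  have hid : BddMeas fun z : spectrum ℂ (complexExt T) => (z : ℂ) := BddMeas.of_continuous
    ((ContinuousMap.id ℂ).restrict (spectrum ℂ (complexExt T)))
  have hlin : BddMeas fun z : spectrum ℂ (complexExt T) => (w.re : ℂ) - z :=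
    (BddMeas.const _).sub hid
  have hpb : BddMeas p := (hlin.mul hlin).add (BddMeas.const _)
  have hpF : E.int p = complexExt F := by
    have h1 : E.int (fun z => (w.re : ℂ) - z) = (w.re : ℂ) • 1 - complexExt T := by
      have h := SpectralMeasure.int_sub (E := E) (BddMeas.const (w.re : ℂ)).essBdd hid.essBdd
      rw [SpectralMeasure.int_const] at h
      exact h.trans (congrArg _ hES.int_id)
    have h2 : E.int p = E.int (fun z => (w.re : ℂ) - z) * E.int (fun z => (w.re : ℂ) - z)
        + ((w.im ^ 2 : ℝ) : ℂ) • 1 := by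
      rw [← SpectralMeasure.int_mul hlin.essBdd hlin.essBdd, ← SpectralMeasure.int_const]
      exact SpectralMeasure.int_add (hlin.mul hlin).essBdd (BddMeas.const _).essBdd
    rw [h2, h1, hF, sq]
    ext a <;> simp [-Complex.coe_smul, -Complex.ofReal_pow]
  have hpr : ∀ z ∈ A', r * r ≤ ‖p z‖ := by
    rintro z ⟨hz, hz'⟩
    rw [hpw, norm_mul]
    have h2 := hrA _ hz'
    have h3 : ‖((specConj T z : spectrum ℂ (complexExt T)) : ℂ) - w‖ = ‖(z : ℂ) - conj w‖ := by
      rw [← RCLike.norm_conj, map_sub]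
      congr 2
      exact Complex.conj_conj _
    rw [h3] at h2
    exact mul_le_mul (hrA z hz) h2 hr.le (norm_nonneg _)
  -- The reciprocal of `p` is bounded by `(r * r)⁻¹` on `A'`, and the cut-off makes it an inverse
  -- modulo `E A`.
  set q : spectrum ℂ (complexExt T) → ℂ := A'.indicator fun z => (p z)⁻¹ with hq
  have hqb : BddMeas q := by
    refine ⟨hpb.1.inv.indicator hA', (r * r)⁻¹, fun z => ?_⟩
    by_cases hz : z ∈ A'
    · rw [hq, indicator_of_mem hz, norm_inv]
      exact inv_anti₀ (by positivity) (hpr z hz)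
    · rw [hq, indicator_of_notMem hz, norm_zero]
      positivity
  have hqp : q * p = A'.indicator fun _ => 1 := by
    ext z
    by_cases hz : z ∈ A'
    · have : p z ≠ 0 := norm_pos_iff.1 ((by positivity : 0 < r * r).trans_le (hpr z hz))
      simp [hq, hz, this]
    · simp [hq, hz]
  have h1 : E.int q * E.int p = E A := by
    rw [← SpectralMeasure.int_mul hqb.essBdd hpb.essBdd, hqp, SpectralMeasure.int_indicator hA',
      hEA']
  have h2 : E.int p * E.int q = E A := by
    rw [← SpectralMeasure.int_mul hpb.essBdd hqb.essBdd, mul_comm, hqp,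
      SpectralMeasure.int_indicator hA', hEA']
  have h3 : E A * E.int q = E.int q := by
    rw [← hEA', ← SpectralMeasure.int_indicator hA', ← SpectralMeasure.int_mul
      ((BddMeas.const 1).indicator hA').essBdd hqb.essBdd]
    congr 1
    ext z
    by_cases hz : z ∈ A' <;> simp [hq, hz]
  -- No symmetry of `q` is required: in each product the other factor is a complexification.
  refine ⟨reOp (E.int q), ?_, ?_, ?_⟩
  · rw [← reOp_mul_complexExt, ← hpF, h1, realSpectralMeasure_eq hE hA]
  · rw [← reOp_complexExt_mul, ← hpF, h2, realSpectralMeasure_eq hE hA]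
  · rw [← reOp_complexExt_mul, complexExt_realSpectralMeasure hE hA, h3]

theorem complexSpectrum_restrict_subset (hES : E.IsSpectralMeasureOf (complexExt T))
    {A : Set (spectrum ℂ (complexExt T))} (hA : MeasurableSet[symmSigma E] A)
    (hTA : ∀ x ∈ (realSpectralMeasure hE A).range, T x ∈ (realSpectralMeasure hE A).range) :
    complexSpectrum (T.restrict hTA) ⊆ closure (Subtype.val '' A) := by
  intro w hw
  by_contra hwA
  obtain ⟨G, hGF, hFG, hG⟩ := exists_inverse_modulo hE hES hA hwA
  have hP : ∀ x ∈ (realSpectralMeasure hE A).range, realSpectralMeasure hE A x = x := by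
    rintro _ ⟨y, rfl⟩
    exact SpectralMeasure.apply_self _ hA y
  -- The identity `E_ℝ(A)G = G` puts the range of `G` in the spectral subspace, so `G` restricts to
  -- an inverse there.
  have hGA : ∀ x ∈ (realSpectralMeasure hE A).range, G x ∈ (realSpectralMeasure hE A).range :=
    fun x _ => ⟨G x, DFunLike.congr_fun hG x⟩
  refine hw ⟨⟨_, G.restrict hGA, ?_, ?_⟩, rfl⟩
  · ext x
    have h := DFunLike.congr_fun hFG x.1
    rw [hP _ x.2] at h
    refine Eq.trans ?_ h
    simp [sq]
  · ext x
    have h := DFunLike.congr_fun hGF x.1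
    rw [hP _ x.2] at h
    refine Eq.trans ?_ h
    simp [sq]

end Calculus

end SpectralTheory

theorem theorem2p4 {H : Type*} [NormedAddCommGroup H] [InnerProductSpace ℝ H] [CompleteSpace H]
    (T : H →L[ℝ] H) (hT : IsStarNormal T) :
    -- the spectral measure `E_ℂ` of `T_ℂ` exists and is unique
    (∃! E : SpectralMeasure (Subtype.instMeasurableSpace : MeasurableSpace (spectrum ℂ (complexExt T)))
        ℂ (Complexification H), E.IsSpectralMeasureOf (complexExt T)) ∧
    ∀ E : SpectralMeasure (Subtype.instMeasurableSpace : MeasurableSpace (spectrum ℂ (complexExt T)))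
        ℂ (Complexification H), E.IsSpectralMeasureOf (complexExt T) →
      -- the σ-algebra of the Borel sets `A` with `E_ℂ(A)♭ = E_ℂ(A)`, equivalently
      -- `E_ℂ(A) = E_ℂ(A')` with `A'` the complex-conjugate set
      ∃ m : MeasurableSpace (spectrum ℂ (complexExt T)),
        (∀ A, MeasurableSet[m] A ↔ MeasurableSet[Subtype.instMeasurableSpace] A ∧ flat (E A) = E A) ∧
        (∀ A, MeasurableSet[m] A ↔ MeasurableSet[Subtype.instMeasurableSpace] A ∧ E A = E (specConj T '' A)) ∧
      -- the real spectral measure `E_ℝ`, and `μ_{x,y}` extends `A ↦ ⟨E_ℝ(A)x, y⟩`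
      ∃ ER : SpectralMeasure m ℝ H,
        (∀ A, MeasurableSet[m] A → ∀ x : H, ofReal (ER A x) = E A (ofReal x)) ∧
        (∀ A, MeasurableSet[m] A → ∀ x y : H,
          E.assoc (ofReal x) (ofReal y) A = ((inner ℝ (ER A x) y : ℝ) : ℂ)) ∧
      ∃ Φ : LinfStem E →ₐ[ℝ] (H →L[ℝ] H),
        -- `⟨Φ(f)x, y⟩ = ∫ f dμ_{x,y}`
        (∀ (f : stemFunctions E) (x y : H),
          (E.assoc (ofReal x) (ofReal y)).Integrable f.1 ∧
          ((inner ℝ (Φ (LinfStem.mk E f) x) y : ℝ) : ℂ) =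
            ∫ᵛ z, f.1 z ∂[ContinuousLinearMap.mul ℝ ℂ; E.assoc (ofReal x) (ofReal y)]) ∧
        -- the same integral against `E_ℝ` itself when `f` is measurable on the small σ-algebra
        (∀ f : stemFunctions E, Measurable[m] f.1 → ∀ x y : H,
          (ER.assoc x y).Integrable f.1 ∧
          ((inner ℝ (Φ (LinfStem.mk E f) x) y : ℝ) : ℂ) = ∫ᵛ z, f.1 z ∂<•(ER.assoc x y)) ∧
        -- `Φ` is isometric
        (∀ f : stemFunctions E, ‖Φ (LinfStem.mk E f)‖ = essNorm E f.1) ∧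
        -- real polynomials
        (∀ p : ℝ[X], ∃ hp : (fun z : spectrum ℂ (complexExt T) => Polynomial.aeval (z : ℂ) p) ∈
            stemFunctions E,
          Φ (LinfStem.mk E ⟨_, hp⟩) = Polynomial.aeval T p) ∧
        -- `Φ(f)` is normal and `Φ(conj f) = Φ(f)*`
        (∀ f : stemFunctions E, IsStarNormal (Φ (LinfStem.mk E f)) ∧
          ∃ hf : (fun z => (starRingEnd ℂ) (f.1 z)) ∈ stemFunctions E,
            Φ (LinfStem.mk E ⟨_, hf⟩) = ContinuousLinearMap.adjoint (Φ (LinfStem.mk E f))) ∧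
        -- `‖Φ(f)x‖² = ∫ |f|² dμ_{x,x}`, where `|f|²` is measurable on the small σ-algebra
        (∀ f : stemFunctions E, Measurable[m] (fun z => ‖f.1 z‖ ^ 2) ∧
          ∀ x : H, (ER.assoc x x).Integrable (fun z => ‖f.1 z‖ ^ 2) ∧
            ‖Φ (LinfStem.mk E f) x‖ ^ 2 = ∫ᵛ z, ‖f.1 z‖ ^ 2 ∂•(ER.assoc x x)) ∧
        -- `σ_ℂ(T | E_ℝ(A)H) ⊆ closure A`
        (∀ A, MeasurableSet[m] A →
          ∃ hA : ∀ x ∈ (ER A).range, T x ∈ (ER A).range,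
            complexSpectrum (T.restrict hA) ⊆ closure (Subtype.val '' A)) ∧
        -- operators commuting with `T` commute with `E_ℝ`
        (∀ S : H →L[ℝ] H, Commute S T → ∀ A, MeasurableSet[m] A → Commute S (ER A)) := by
  have hTC := Complexification.isStarNormal_complexExt T hT
  obtain ⟨E₀, hE₀⟩ := SpectralMeasure.exists_isSpectralMeasureOf hTC
  refine ⟨⟨E₀, hE₀, fun F hF => hF.unique hTC hE₀⟩, fun E hES => ?_⟩
  have hE : E.conjugate = E := hES.conjugate_eq hT
  refine ⟨symmSigma E, fun A => ?_, fun A => ?_, realSpectralMeasure hE,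
    fun A hA x => ofReal_realSpectralMeasure hE hA x, fun A hA x y => assoc_ofReal hE hA x y,
    linfCalculus hE,
    fun f x y => ⟨(essBdd_of_stem f).integrable_variation _ _, inner_linfCalculus hE f x y⟩,
    fun f hf x y => ?_, fun f => ?_, linfCalculus_polynomial hE hES,
    fun f => ⟨isStarNormal_linfCalculus hE f, conj_mem_stemFunctions f, linfCalculus_conj hE f⟩,
    fun f => ⟨measurable_norm_sq_stem f, fun x => ?_⟩, fun A hA => ?_,
    fun S hS A hA => commute_realSpectralMeasure hE hT hES hS hA⟩
  · rw [measurableSet_symmSigma_iff, flat_apply_eq hE, eq_comm (a := E A)]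
  · rw [measurableSet_symmSigma_iff, specConj_involutive.image_eq_preimage_symm]
  · rw [inner_linfCalculus]
    exact form_ofReal hE (essBdd_of_stem f) hf x y
  · rw [← Complexification.norm_complexExt, complexExt_linfCalculus]
    exact SpectralMeasure.norm_int (essBdd_of_stem f)
  · rw [← Complexification.norm_ofReal, ← Complexification.complexExt_ofReal,
      complexExt_linfCalculus]
    exact norm_int_sq_ofReal hE (essBdd_of_stem f) (measurable_norm_sq_stem f) x
  · refine ⟨?_, complexSpectrum_restrict_subset hE hES hA _⟩
    rintro _ ⟨y, rfl⟩
    have h := commute_realSpectralMeasure hE hT hES (Commute.refl T) hA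
    exact ⟨T y, (DFunLike.congr_fun h.eq y).symm⟩
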